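/- Let $\mathcal M$ be a von Neumann algebra acting on a complex Hilbert space $\mathcal H$, with a normal semifinite faithful trace $\tau$. Let $L_0(\mathcal M,\tau)$ be the $*$-algebra of $\tau$-measurable operators, that is, of the closed densely defined operators $x$ affiliated with $\mathcal M$ such that for every $\epsilon>0$ there is a projection $e\in\mathcal M$ with $\tau(\mathbf 1-e)\le\epsilon$ and $xe\in\mathcal M$; sums and differences in $L_0(\mathcal M,\tau)$ are closures of the algebraic ones. Write $x\ge 0$ if $\langle x\xi,\xi\rangle\ge 0$ for all $\xi$ in the domain of $x$, and $x\le y$ if $y-x\ge 0$. Fix $1\le p<\infty$, let $\|x\|_p=\tau(|x|^p)^{1/p}$, and let $L_p(\mathcal M,\tau)^+$ be the set of all $x\in L_0(\mathcal M,\tau)$ with $x\ge0$ and $\|x\|_p<\infty$. Let $T:\mathcal M\to\mathcal M$ be a normal $\tau$-preserving $*$-automorphism, and denote its canonical (isometric) extension to $L_p(\mathcal M,\tau)$ by $T$ as well. Call a sequence $(u_k)_{k=0}^\infty$ $T$-admissible if $T(u_k)\le u_{k+1}$ for every $k\ge 0$, and strongly $p$-bounded if $\sup_{k\ge 0}\|u_k\|_p<\infty$.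 Let $(x_k)_{k=0}^\infty\subset L_p(\mathcal M,\tau)^+$ be a strongly $p$-bounded sequence such that there exists a sequence $(r_k)_{k=0}^\infty\subset L_p(\mathcal M,\tau)^+$ with $\sum_{j=0}^\infty\|r_j\|_p<\infty$ and $$T(x_k)\le x_{k+1}+r_{k+1}\qquad\text{for every } k\ge 0 .$$ Then there exist strongly $p$-bounded $T$-admissible sequences $(y_k)_{k=0}^\infty,(z_k)_{k=0}^\infty\subset L_p(\mathcal M,\tau)^+$ such that $$x_k=y_k-z_k\qquad\text{for every } k\ge 0 .$$ -/

import Mathlib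

open scoped ENNReal NNReal ComplexOrder

/-! ### Semifinite von Neumann algebras -/

/-- A normal semifinite faithful trace `τ : M₊ → [0, ∞]` on a von Neumann algebra `M` acting on `H`.
It is represented by a function on all bounded operators; only its values on positive elements
of `M` are meaningful, and only these are ever constrained or used. -/
structure NSFTrace {H : Type*} [NormedAddCommGroup H] [InnerProductSpace ℂ H] [CompleteSpace H]
    (M : VonNeumannAlgebra H) where
  toFun : (H →L[ℂ] H) → ℝ≥0∞
  map_add : ∀ a b : H →L[ℂ] H, a ∈ M → b ∈ M → 0 ≤ a → 0 ≤ b → toFun (a + b) = toFun a + toFun b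
  map_smul : ∀ (c : ℝ≥0) (a : H →L[ℂ] H), a ∈ M → 0 ≤ a →
    toFun (((c : ℝ) : ℂ) • a) = (c : ℝ≥0∞) * toFun a
  tracial : ∀ a : H →L[ℂ] H, a ∈ M → toFun (star a * a) = toFun (a * star a)
  /-- `τ (sup D) = sup τ(D)` for every upward directed set `D` in `M₊` with a supremum in `M`. -/
  normal : ∀ (D : Set (H →L[ℂ] H)) (s : H →L[ℂ] H), D.Nonempty → DirectedOn (· ≤ ·) D →
    (∀ a ∈ D, a ∈ M ∧ 0 ≤ a) → s ∈ M → IsLUB D s → toFun s = ⨆ a ∈ D, toFun a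
  faithful : ∀ a : H →L[ℂ] H, a ∈ M → 0 ≤ a → toFun a = 0 → a = 0
  semifinite : ∀ a : H →L[ℂ] H, a ∈ M → 0 ≤ a → a ≠ 0 →
    ∃ b : H →L[ℂ] H, b ∈ M ∧ 0 ≤ b ∧ b ≤ a ∧ b ≠ 0 ∧ toFun b < ∞

namespace NCLp

noncomputable section

variable {H : Type*} [NormedAddCommGroup H] [InnerProductSpace ℂ H] [CompleteSpace H]

/-- A `*`-automorphism `T` of `M` is normal if it preserves suprema of bounded upward directed
sets of positive elements. -/
def IsNormalAut {M : VonNeumannAlgebra H} (T : M.toStarSubalgebra ≃⋆ₐ[ℂ] M.toStarSubalgebra) :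
    Prop :=
  ∀ (D : Set M.toStarSubalgebra) (s : M.toStarSubalgebra), D.Nonempty →
    DirectedOn (· ≤ ·) ((fun a : M.toStarSubalgebra => (a : H →L[ℂ] H)) '' D) →
    (∀ a ∈ D, 0 ≤ (a : H →L[ℂ] H)) →
    IsLUB ((fun a : M.toStarSubalgebra => (a : H →L[ℂ] H)) '' D) s →
    IsLUB ((fun a : M.toStarSubalgebra => (T a : H →L[ℂ] H)) '' D) (T s)

/-- `τ (T a) = τ a` for every `a ∈ M₊`. -/
def IsTracePreserving {M : VonNeumannAlgebra H} (τ : NSFTrace M)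
    (T : M.toStarSubalgebra ≃⋆ₐ[ℂ] M.toStarSubalgebra) : Prop :=
  ∀ a : M.toStarSubalgebra, 0 ≤ (a : H →L[ℂ] H) → τ.toFun (T a) = τ.toFun a

/-! ### Measurable operators -/

/-- `x` is affiliated with `M`: `y x ⊆ x y` for every `y` in the commutant of `M`. -/
def IsAffiliated (M : VonNeumannAlgebra H) (x : H →ₗ.[ℂ] H) : Prop :=
  ∀ y ∈ M.commutant, ∀ ξ : x.domain, ((y ξ, y (x ξ)) : H × H) ∈ x.graph

/-- `b` is the (everywhere defined) product `x a`: the range of `a` lies in the domain of `x`, and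
`x (a ξ) = b ξ` for all `ξ`. -/
def IsMulBounded (x : H →ₗ.[ℂ] H) (a b : H →L[ℂ] H) : Prop :=
  ∀ ξ : H, ((a ξ, b ξ) : H × H) ∈ x.graph

/-- `L₀(M, τ)`: the closed densely defined operators `x` affiliated with `M` which are
`τ`-measurable, i.e. for every `ε > 0` there is a projection `e ∈ M` with `τ(1 - e) ≤ ε` and
`x e ∈ M`. -/
structure MemL0 {M : VonNeumannAlgebra H} (τ : NSFTrace M) (x : H →ₗ.[ℂ] H) : Prop where
  dense : Dense (x.domain : Set H)
  closed : x.IsClosed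
  affiliated : IsAffiliated M x
  measurable : ∀ ε : ℝ≥0∞, 0 < ε → ∃ e : H →L[ℂ] H, e ∈ M ∧ IsStarProjection e ∧
    τ.toFun (1 - e) ≤ ε ∧ ∃ b ∈ M, IsMulBounded x e b

/-- `x ≥ 0`: `⟨x ξ, ξ⟩ ≥ 0` (a nonnegative real number) for every `ξ` in the domain of `x`. -/
def IsPos (x : H →ₗ.[ℂ] H) : Prop :=
  ∀ ξ : x.domain, 0 ≤ inner ℂ (x ξ) (ξ : H)

/-- The closed sum, i.e. the sum in the `*`-algebra `L₀(M, τ)`. -/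
def closedAdd (x y : H →ₗ.[ℂ] H) : H →ₗ.[ℂ] H := (x + y).closure

/-- The closed difference, i.e. the difference in the `*`-algebra `L₀(M, τ)`. -/
def closedSub (x y : H →ₗ.[ℂ] H) : H →ₗ.[ℂ] H := (x - y).closure

/-- The operator ordering: `x ≤ y` if the difference `y - x` in `L₀(M, τ)` is positive. -/
def OpLE (x y : H →ₗ.[ℂ] H) : Prop := IsPos (closedSub y x)

/-! ### Noncommutative `L_p` spaces -/

/-- The graph of `x` as a closed subspace of the Hilbert space `H ⊕ H` (if `x` is not closed,
its closure is taken). -/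
def hilbertGraph (x : H →ₗ.[ℂ] H) : Submodule ℂ (WithLp 2 (H × H)) :=
  (x.graph.comap (WithLp.linearEquiv 2 ℂ (H × H)).toLinearMap).topologicalClosure

instance (x : H →ₗ.[ℂ] H) : CompleteSpace (hilbertGraph x) :=
  (Submodule.isClosed_topologicalClosure _).completeSpace_coe

/-- The bounded positive contraction `(1 + x* x)⁻¹ = (1 + |x|²)⁻¹`, for `x` closed and densely
defined: the upper left corner of the orthogonal projection of `H ⊕ H` onto the graph of `x`.
Indeed, if `(a, x a)` is the projection of `(ξ, 0)`, then `(ξ - a, - x a)` is orthogonal to the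
graph of `x`, which means that `x a ∈ dom x*` and `a + x* x a = ξ`. -/
def invOneAddAbsSq (x : H →ₗ.[ℂ] H) : H →L[ℂ] H :=
  (WithLp.fstL 2 ℂ H H) ∘L (hilbertGraph x).starProjection ∘L
    (WithLp.prodContinuousLinearEquiv 2 ℂ H H).symm.toContinuousLinearMap ∘L
    ContinuousLinearMap.inl ℂ H H

/-- The bounded operator `(min (|x|, n))^p`, a bounded continuous function of `|x|`. It is computed
as a continuous function of `s = (1 + |x|²)⁻¹`: for `s = (1 + λ²)⁻¹`, `λ ≥ 0`, one has
`min (λ, n) = √(1 / max (s, (1 + n²)⁻¹) - 1)`, and the value at `s = 0` is `n`. -/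
def truncAbsPow (p : ℝ) (n : ℕ) (x : H →ₗ.[ℂ] H) : H →L[ℂ] H :=
  cfc (fun s : ℝ => (Real.sqrt (1 / max s (1 / (1 + (n : ℝ) ^ 2)) - 1)) ^ p) (invOneAddAbsSq x)

/-- `‖x‖_p = τ(|x|^p)^{1/p} ∈ [0, ∞]`, where the trace of the positive operator `|x|^p` is the
supremum of the traces of its bounded truncations. (Since `τ` is normal, truncating as
`min (|x|, n)^p` gives the same supremum as cutting off the spectral integral of `|x|^p`.) -/
def lpNorm {M : VonNeumannAlgebra H} (τ : NSFTrace M) (p : ℝ) (x : H →ₗ.[ℂ] H) : ℝ≥0∞ :=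
  (⨆ n : ℕ, τ.toFun (truncAbsPow p n x)) ^ (1 / p)

/-- `x ∈ L_p(M, τ)`. -/
def MemLp {M : VonNeumannAlgebra H} (τ : NSFTrace M) (p : ℝ) (x : H →ₗ.[ℂ] H) : Prop :=
  MemL0 τ x ∧ lpNorm τ p x < ∞

/-- `x ∈ L_p(M, τ)⁺`. -/
def MemLpPos {M : VonNeumannAlgebra H} (τ : NSFTrace M) (p : ℝ) (x : H →ₗ.[ℂ] H) : Prop :=
  MemLp τ p x ∧ IsPos x

/-! ### Extension of automorphisms, admissible processes -/

/-- The closed linear span in `H × H` of all `(T(a) ξ, T(x a) ξ)`, where `ξ ∈ H` and `a ∈ M` is such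
that `x a ∈ M`. -/
def extGraph {M : VonNeumannAlgebra H} (T : M.toStarSubalgebra ≃⋆ₐ[ℂ] M.toStarSubalgebra)
    (x : H →ₗ.[ℂ] H) : Submodule ℂ (H × H) :=
  (Submodule.span ℂ {v : H × H | ∃ a b : M.toStarSubalgebra, IsMulBounded x a b ∧
    ∃ ξ : H, v = ((T a : H →L[ℂ] H) ξ, (T b : H →L[ℂ] H) ξ)}).topologicalClosure

/-- The canonical extension of a `*`-automorphism `T` of `M` to operators affiliated with `M`: `T(x)`
is the closed operator generated by the rule `T(x) T(a) = T(x a)` for `a, x a ∈ M`. For a trace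
preserving `T` its restrictions to the spaces `L_p(M, τ)` are the isometric extensions of `T`. -/
def extend {M : VonNeumannAlgebra H} (T : M.toStarSubalgebra ≃⋆ₐ[ℂ] M.toStarSubalgebra)
    (x : H →ₗ.[ℂ] H) : H →ₗ.[ℂ] H :=
  (extGraph T x).toLinearPMap

/-- The sequence `x` is `T`-admissible: `T(x_k) ≤ x_{k+1}` for all `k`. -/
def IsAdmissible {M : VonNeumannAlgebra H} (T : M.toStarSubalgebra ≃⋆ₐ[ℂ] M.toStarSubalgebra)
    (x : ℕ → H →ₗ.[ℂ] H) : Prop :=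
  ∀ k, OpLE (extend T (x k)) (x (k + 1))

/-- The sequence `x` is strongly `p`-bounded: `sup_k ‖x_k‖_p < ∞`. -/
def IsStronglyBounded {M : VonNeumannAlgebra H} (τ : NSFTrace M) (p : ℝ)
    (x : ℕ → H →ₗ.[ℂ] H) : Prop :=
  ⨆ k, lpNorm τ p (x k) < ∞

end

end NCLp

/-!
Put `z_0 = r_0`, `z_{k+1} = T z_k + r_{k+1}` and `y_k = x_k + z_k`. Then `T z_k ≤ z_{k+1}` because
`r_{k+1} ≥ 0`, and `T y_k = T x_k + T z_k ≤ x_{k+1} + r_{k+1} + T z_k = y_{k+1}`. As `T` is isometric,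
`‖z_k‖_p ≤ ∑_{j ≤ k} ‖r_j‖_p`. What has to be supplied is the calculus of measurable operators that
gives these lines a meaning.

* Algebra. The basic comparison is `dim_ker_orthogonal_le`: the support of an operator of `M` whose
  range lies in `K` is not larger than `K`. It implies that the intersection of `τ`-dense subspaces
  is `τ`-dense, and that a `τ`-dense subspace of the domain is a core for a closed operator affiliated
  with `M` (`graph_le_closure_of_tauDense`). So identities and inequalities between elements of
  `L₀(M, τ)` need only be verified on a `τ`-dense subspace (`eq_of_agree`,
  `L0sa.isPos_of_tauDense`). All operators in play are positive or differences of positive ones,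
  so sums are symmetric, hence closable, and closed symmetric elements of `L₀(M, τ)` are
  selfadjoint (`L0sa.mem_graph_of_inner`).
* The automorphism. `T` maps the projection onto the graph of `x` to that onto the graph of `T(x)`
  (`inv_extend`), and commutes with the functional calculus, so it preserves `‖·‖_p`. Additivity and
  positivity of the extension are checked on `τ`-dense subspaces.
* Minkowski's inequality `lpNorm_closedAdd_le`. On a vector `ξ` in the spectral subspace where
  `x + y ≥ l`, the tangent line inequality for `t ↦ t ^ p`, applied to `x` at `α l` and to `y` at
  `β l` with `α + β = 1`, gives `l ^ p ‖ξ‖² ≤ α ^ (1 - p) ⟨x ^ p ξ, ξ⟩ + β ^ (1 - p) ⟨y ^ p ξ, ξ⟩`.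
  Taking traces over the spectral bands of `x + y` between the points of a geometric ladder bounds
  the Riemann sums of `τ((x + y) ^ p)`. The ratio of the ladder tends to `1`, and `α : β` is chosen
  as `‖x‖_p : ‖y‖_p`.
-/

set_option linter.unusedSectionVars false

namespace NCLp

variable {H : Type*} [NormedAddCommGroup H] [InnerProductSpace ℂ H] [CompleteSpace H]
  {M : VonNeumannAlgebra H}

open Filter Topology

/-! ### Quadratic forms of bounded operators -/

theorem nonneg_iff_inner {a : H →L[ℂ] H} : 0 ≤ a ↔ ∀ ξ, 0 ≤ inner ℂ (a ξ) ξ := by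
  rw [ContinuousLinearMap.nonneg_iff_isPositive, ContinuousLinearMap.isPositive_iff_complex]
  refine forall_congr' fun ξ => ?_
  rw [Complex.nonneg_iff]
  constructor
  · rintro ⟨h1, h2⟩
    refine ⟨h2, ?_⟩
    rw [← h1]; simp
  · rintro ⟨h1, h2⟩
    refine ⟨?_, h1⟩
    apply Complex.ext
    · simp
    · simpa using h2

theorem le_iff_inner {a b : H →L[ℂ] H} : a ≤ b ↔ ∀ ξ, inner ℂ (a ξ) ξ ≤ inner ℂ (b ξ) ξ := by
  rw [← sub_nonneg, nonneg_iff_inner]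
  refine forall_congr' fun ξ => ?_
  rw [sub_apply, inner_sub_left, sub_nonneg]

theorem inner_self_complex (ξ : H) : inner ℂ ξ ξ = ((‖ξ‖ ^ 2 : ℝ) : ℂ) := by
  rw [inner_self_eq_norm_sq_to_K]; simp

theorem inner_real_of_nonneg {a : H →L[ℂ] H} (ha : 0 ≤ a) (ξ : H) :
    inner ℂ (a ξ) ξ = (((inner ℂ (a ξ) ξ).re : ℝ) : ℂ) := by
  have h := nonneg_iff_inner.1 ha ξ
  rw [Complex.nonneg_iff] at h
  apply Complex.ext
  · simp
  · simpa using h.2.symm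

theorem inner_isSelfAdjoint {a : H →L[ℂ] H} (ha : IsSelfAdjoint a) (ξ η : H) :
    inner ℂ (a ξ) η = inner ℂ ξ (a η) := by
  conv_lhs => rw [← ha.star_eq, ContinuousLinearMap.star_eq_adjoint]
  exact ContinuousLinearMap.adjoint_inner_left _ _ _

theorem isSelfAdjoint_of_inner {a : H →L[ℂ] H} (h : ∀ ξ η, inner ℂ (a ξ) η = inner ℂ ξ (a η)) :
    IsSelfAdjoint a := by
  rw [ContinuousLinearMap.isSelfAdjoint_iff_isSymmetric]
  exact h

theorem inner_star_left (a : H →L[ℂ] H) (ξ η : H) :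
    inner ℂ (star a ξ) η = inner ℂ ξ (a η) :=
  ContinuousLinearMap.adjoint_inner_left _ _ _

theorem inner_star_right (a : H →L[ℂ] H) (ξ η : H) :
    inner ℂ ξ (star a η) = inner ℂ (a ξ) η :=
  ContinuousLinearMap.adjoint_inner_right _ _ _

/-! ### Membership in a von Neumann algebra -/

theorem mem_iff_commutant {a : H →L[ℂ] H} : a ∈ M ↔ ∀ y ∈ M.commutant, ∀ ξ, y (a ξ) = a (y ξ) := by
  conv_lhs => rw [← M.commutant_commutant, VonNeumannAlgebra.mem_commutant_iff]
  refine forall₂_congr fun y _ => ?_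
  rw [ContinuousLinearMap.ext_iff]
  rfl

theorem cfc_mem {a : H →L[ℂ] H} (ha : a ∈ M) (f : ℝ → ℝ) : cfc f a ∈ M := by
  by_cases hs : IsSelfAdjoint a
  · rw [mem_iff_commutant]
    intro y hy ξ
    have hc : Commute a y := (VonNeumannAlgebra.mem_commutant_iff.1 hy a ha)
    have := (hc.cfc_real f).eq
    exact (congrArg (fun t : H →L[ℂ] H => t ξ) this).symm
  · rw [cfc_apply_of_not_predicate _ hs]
    exact zero_mem M

theorem smul_mem_algebra {a : H →L[ℂ] H} (c : ℂ) (ha : a ∈ M) : c • a ∈ M :=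
  M.toStarSubalgebra.smul_mem ha c

/-! ### Subspaces and their projections -/

/-- The orthogonal projection onto the closure of the subspace `K`. -/
noncomputable def proj (K : Submodule ℂ H) : H →L[ℂ] H := K.topologicalClosure.starProjection

theorem proj_isStarProjection (K : Submodule ℂ H) : IsStarProjection (proj K) :=
  isStarProjection_starProjection

theorem proj_isSelfAdjoint (K : Submodule ℂ H) : IsSelfAdjoint (proj K) :=
  (proj_isStarProjection K).isSelfAdjoint

theorem proj_mul_self (K : Submodule ℂ H) : proj K * proj K = proj K :=
  (proj_isStarProjection K).isIdempotentElem

theorem inner_proj (K : Submodule ℂ H) (ξ : H) : inner ℂ (proj K ξ) ξ = ((‖proj K ξ‖ ^ 2 : ℝ) : ℂ) := by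
  rw [← inner_self_complex, ← inner_isSelfAdjoint (proj_isSelfAdjoint K)]
  exact (congrArg (fun t : H →L[ℂ] H => inner ℂ (t ξ) ξ) (proj_mul_self K)).symm

theorem proj_nonneg (K : Submodule ℂ H) : 0 ≤ proj K := (proj_isStarProjection K).nonneg

theorem sub_proj_mem (K : Submodule ℂ H) (ξ : H) : ξ - proj K ξ ∈ Kᗮ := by
  rw [← Submodule.orthogonal_closure]
  exact Submodule.sub_starProjection_mem_orthogonal ξ

theorem proj_orthogonal (K : Submodule ℂ H) : proj Kᗮ = 1 - proj K := by
  unfold proj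
  rw [← Submodule.starProjection_orthogonal', Submodule.starProjection_inj,
    (Submodule.isClosed_orthogonal K).submodule_topologicalClosure_eq, Submodule.orthogonal_closure]

theorem closure_eq {K : Submodule ℂ H} (hK : IsClosed (K : Set H)) : K.topologicalClosure = K :=
  hK.submodule_topologicalClosure_eq

theorem proj_mem {K : Submodule ℂ H} (hK : IsClosed (K : Set H)) (ξ : H) : proj K ξ ∈ K := by
  exact (closure_eq hK).le (K.topologicalClosure.starProjection_apply_mem ξ)

theorem proj_eq_self {K : Submodule ℂ H} {ξ : H} (h : ξ ∈ K) : proj K ξ = ξ :=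
  Submodule.starProjection_eq_self_iff.2 (K.le_topologicalClosure h)

theorem proj_eq_zero {K : Submodule ℂ H} {ξ : H} (h : ξ ∈ Kᗮ) : proj K ξ = 0 := by
  have := proj_eq_self h
  rw [proj_orthogonal] at this
  simpa using this

theorem mem_orthogonal_of_proj_eq_zero {K : Submodule ℂ H} {ξ : H} (h : proj K ξ = 0) : ξ ∈ Kᗮ := by
  simpa [h] using sub_proj_mem K ξ

theorem norm_proj_le (K : Submodule ℂ H) (ξ : H) : ‖proj K ξ‖ ≤ ‖ξ‖ :=
  K.topologicalClosure.norm_starProjection_apply_le ξ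

theorem eq_proj {K : Submodule ℂ H} {ξ η : H} (h : η ∈ K) (h' : ξ - η ∈ Kᗮ) : proj K ξ = η := by
  have h1 := proj_eq_zero h'
  rw [map_sub, proj_eq_self h, sub_eq_zero] at h1
  exact h1

/-- A closed subspace is affiliated with `M` if it is invariant under the commutant of `M`,
that is, if its orthogonal projection belongs to `M`. -/
structure IsAff (M : VonNeumannAlgebra H) (K : Submodule ℂ H) : Prop where
  closed : IsClosed (K : Set H)
  map_mem : ∀ y ∈ M.commutant, ∀ ξ ∈ K, y ξ ∈ K

theorem IsAff.orthogonal_of_invariant {K : Submodule ℂ H}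
    (h : ∀ y ∈ M.commutant, ∀ ξ ∈ K, y ξ ∈ K) : IsAff M Kᗮ where
  closed := Submodule.isClosed_orthogonal K
  map_mem y hy ξ hξ := by
    rw [Submodule.mem_orthogonal'] at hξ ⊢
    intro u hu
    have h1 := hξ _ (h (star y) (star_mem hy) u hu)
    rwa [inner_star_right] at h1

theorem IsAff.orthogonal {K : Submodule ℂ H} (h : IsAff M K) : IsAff M Kᗮ :=
  IsAff.orthogonal_of_invariant h.map_mem

theorem IsAff.inf {K L : Submodule ℂ H} (hK : IsAff M K) (hL : IsAff M L) : IsAff M (K ⊓ L) where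
  closed := hK.closed.inter hL.closed
  map_mem y hy ξ hξ := ⟨hK.map_mem y hy ξ hξ.1, hL.map_mem y hy ξ hξ.2⟩

theorem IsAff.proj_mem {K : Submodule ℂ H} (hK : IsAff M K) : proj K ∈ M := by
  rw [mem_iff_commutant]
  intro y hy ξ
  refine (eq_proj (hK.map_mem y hy _ (NCLp.proj_mem hK.closed ξ)) ?_).symm
  rw [← map_sub]
  exact hK.orthogonal.map_mem y hy _ (sub_proj_mem K ξ)

theorem IsAff.ker {a : H →L[ℂ] H} (ha : a ∈ M) : IsAff M (LinearMap.ker a.toLinearMap) where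
  closed := a.isClosed_ker
  map_mem y hy ξ hξ := by
    have := mem_iff_commutant.1 ha y hy ξ
    simp only [LinearMap.mem_ker, ContinuousLinearMap.coe_coe] at hξ ⊢
    rw [← this, hξ, map_zero]

theorem IsAff.of_isStarProjection {e : H →L[ℂ] H} (he : IsStarProjection e) (heM : e ∈ M) :
    ∃ K, IsAff M K ∧ proj K = e := by
  refine ⟨(LinearMap.ker e.toLinearMap)ᗮ, (IsAff.ker heM).orthogonal, ?_⟩
  ext ξ
  have hid : ∀ η, e (e η) = e η := fun η =>
    congrArg (fun t : H →L[ℂ] H => t η) he.isIdempotentElem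
  refine eq_proj ?_ ?_
  · rw [Submodule.mem_orthogonal]
    intro u hu
    rw [← inner_isSelfAdjoint he.isSelfAdjoint]
    have : e u = 0 := hu
    rw [this, inner_zero_left]
  · refine Submodule.le_orthogonal_orthogonal _ ?_
    simp [LinearMap.mem_ker, hid]

/-- For subspaces `A ≤ B`, the projection onto `B` splits. -/
theorem proj_add_proj {A B : Submodule ℂ H} (hA : IsClosed (A : Set H)) (hB : IsClosed (B : Set H))
    (h : A ≤ B) : proj B = proj A + proj (B ⊓ Aᗮ) := by
  ext ξ
  have h1 : proj (B ⊓ Aᗮ) ξ = proj B ξ - proj A ξ := by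
    refine eq_proj ⟨B.sub_mem (proj_mem hB ξ) (h (proj_mem hA ξ)), ?_⟩ ?_
    · have h2 := Submodule.sub_mem _ (sub_proj_mem A ξ)
        (Submodule.orthogonal_le h (sub_proj_mem B ξ))
      simpa using h2
    · have h2 : ξ - (proj B ξ - proj A ξ) = (ξ - proj B ξ) + proj A ξ := by abel
      rw [h2]
      refine Submodule.add_mem _ (Submodule.orthogonal_le inf_le_left (sub_proj_mem B ξ)) ?_
      exact Submodule.orthogonal_le inf_le_right
        (Submodule.le_orthogonal_orthogonal _ (proj_mem hA ξ))
  rw [add_apply, h1]; abel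

/-! ### The trace -/

variable (τ : NSFTrace M)

theorem trace_mono {a b : H →L[ℂ] H} (ha : a ∈ M) (hb : b ∈ M) (h0 : 0 ≤ a) (hab : a ≤ b) :
    τ.toFun a ≤ τ.toFun b := by
  have h := τ.map_add a (b - a) ha (sub_mem hb ha) h0 (sub_nonneg.2 hab)
  rw [add_sub_cancel] at h
  rw [h]; exact le_self_add

theorem trace_zero : τ.toFun 0 = 0 := by
  have := τ.map_smul 0 0 (zero_mem M) le_rfl
  simpa using this

/-- Normality, for increasing sequences that converge in the weak operator topology. -/
theorem trace_eq_iSup {a : ℕ → H →L[ℂ] H} {b : H →L[ℂ] H} (ha : ∀ n, a n ∈ M) (h0 : ∀ n, 0 ≤ a n)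
    (hmono : Monotone a) (hb : b ∈ M)
    (hlim : ∀ ξ, Tendsto (fun n => inner ℂ (a n ξ) ξ) atTop (𝓝 (inner ℂ (b ξ) ξ))) :
    τ.toFun b = ⨆ n, τ.toFun (a n) := by
  have hle : ∀ n, a n ≤ b := fun n => le_iff_inner.2 fun ξ =>
    ge_of_tendsto (hlim ξ) (eventually_atTop.2 ⟨n, fun m hm => le_iff_inner.1 (hmono hm) ξ⟩)
  have h := τ.normal (Set.range a) b (Set.range_nonempty a) ?_ ?_ hb ?_
  · rw [h, iSup_range]
  · rintro _ ⟨n, rfl⟩ _ ⟨m, rfl⟩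
    exact ⟨a (max n m), ⟨_, rfl⟩, hmono (le_max_left _ _), hmono (le_max_right _ _)⟩
  · rintro _ ⟨n, rfl⟩
    exact ⟨ha n, h0 n⟩
  · constructor
    · rintro _ ⟨n, rfl⟩
      exact hle n
    · intro c hc
      refine le_iff_inner.2 fun ξ => le_of_tendsto (hlim ξ) (Eventually.of_forall fun n => ?_)
      exact le_iff_inner.1 (hc ⟨n, rfl⟩) ξ

/-- The relative dimension of a subspace: the trace of its projection. -/
noncomputable def dim (K : Submodule ℂ H) : ℝ≥0∞ := τ.toFun (proj K)

variable {τ}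

theorem proj_le_proj {K L : Submodule ℂ H} (hK : IsClosed (K : Set H)) (hL : IsClosed (L : Set H))
    (h : K ≤ L) : proj K ≤ proj L := by
  rw [proj_add_proj hK hL h]
  exact le_add_of_nonneg_right (proj_nonneg _)

theorem dim_mono {K L : Submodule ℂ H} (hK : IsAff M K) (hL : IsAff M L) (h : K ≤ L) :
    dim τ K ≤ dim τ L :=
  trace_mono τ hK.proj_mem hL.proj_mem (proj_nonneg K) (proj_le_proj hK.closed hL.closed h)

theorem eq_bot_of_dim_eq_zero {K : Submodule ℂ H} (hK : IsAff M K) (h : dim τ K = 0) : K = ⊥ := by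
  have := τ.faithful _ hK.proj_mem (proj_nonneg K) h
  rw [eq_bot_iff]
  intro ξ hξ
  rw [Submodule.mem_bot, ← proj_eq_self hξ, this]; rfl

theorem cfc_isSelfAdjoint (f : ℝ → ℝ) (a : H →L[ℂ] H) : IsSelfAdjoint (cfc f a) :=
  cfc_predicate f a

theorem inner_star_mul (c : H →L[ℂ] H) (ξ : H) :
    inner ℂ ((star c * c) ξ) ξ = ((‖c ξ‖ ^ 2 : ℝ) : ℂ) := by
  rw [← inner_self_complex]; exact inner_star_left _ _ _

/-- If the range of `c` lies in `K`, the support projection of `c` has at most the trace of the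
projection onto `K`. With `kₙ(t) = n / (1 + n t)` and `v = c kₙ(c* c)^{1/2}`, the operators `v* v`
increase to the support projection of `c` as `n → ∞`, while `v v*` is dominated by the projection
onto `K`. This replaces the polar decomposition of `c`. -/
theorem dim_ker_orthogonal_le {c : H →L[ℂ] H} (hc : c ∈ M) {K : Submodule ℂ H} (hK : IsAff M K)
    (hcK : ∀ ξ, c ξ ∈ K) : dim τ (LinearMap.ker c.toLinearMap)ᗮ ≤ dim τ K := by
  set d : H →L[ℂ] H := star c * c with hd
  have hdM : d ∈ M := mul_mem (star_mem hc) hc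
  have hd0 : 0 ≤ d := star_mul_self_nonneg c
  have hdsa : IsSelfAdjoint d := hd0.isSelfAdjoint
  have hsp : ∀ t ∈ spectrum ℝ d, 0 ≤ t := fun t ht => spectrum_nonneg_of_nonneg hd0 ht
  let r : ℕ → ℝ → ℝ := fun n t => Real.sqrt (n / (1 + n * t))
  let h : ℕ → ℝ → ℝ := fun n t => n * t / (1 + n * t)
  have hpos : ∀ (n : ℕ) (t : ℝ), t ∈ spectrum ℝ d → 0 < 1 + n * t := fun n t ht => by
    have := mul_nonneg (Nat.cast_nonneg (α := ℝ) n) (hsp t ht); linarith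
  have hr : ∀ n, ContinuousOn (r n) (spectrum ℝ d) := fun n => by
    refine (ContinuousOn.div continuousOn_const (by fun_prop) fun t ht => (hpos n t ht).ne').sqrt
  have hh : ∀ n, ContinuousOn (h n) (spectrum ℝ d) := fun n =>
    ContinuousOn.div (by fun_prop) (by fun_prop) fun t ht => (hpos n t ht).ne'
  have hhval : ∀ n, cfc (r n) d * d * cfc (r n) d = cfc (h n) d := fun n => by
    have e2 : cfc (r n) d * d = cfc (fun t => r n t * t) d := by
      rw [cfc_mul (r n) (fun t => t) d (hr n) continuousOn_id, cfc_id' ℝ d]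
    rw [e2, ← cfc_mul (fun t => r n t * t) (r n) d ((hr n).mul continuousOn_id) (hr n)]
    refine cfc_congr fun t ht => ?_
    have h1 : (0:ℝ) ≤ n / (1 + n * t) := div_nonneg (Nat.cast_nonneg n) (hpos n t ht).le
    have h2 : r n t * r n t = n / (1 + n * t) := Real.mul_self_sqrt h1
    calc r n t * t * r n t = (r n t * r n t) * t := by ring
      _ = h n t := by rw [h2]; simp only [h]; ring
  let v : ℕ → H →L[ℂ] H := fun n => c * cfc (r n) d
  have hvM : ∀ n, v n ∈ M := fun n => mul_mem hc (cfc_mem hdM _)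
  have hvv : ∀ n, star (v n) * v n = cfc (h n) d := fun n => by
    simp only [v, star_mul, (cfc_isSelfAdjoint (r n) d).star_eq]
    rw [← hhval n, hd]; noncomm_ring
  have hh0 : ∀ n, 0 ≤ cfc (h n) d := fun n => by rw [← hvv n]; exact star_mul_self_nonneg _
  have hh1 : ∀ n, cfc (h n) d ≤ 1 := fun n => by
    refine cfc_le_one _ _ fun t ht => ?_
    simp only [h]
    rw [div_le_one (hpos n t ht)]; linarith
  have hmono : Monotone fun n => cfc (h n) d := fun n m hnm => by
    refine cfc_mono (fun t ht => ?_) (hh n) (hh m)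
    simp only [h]
    rw [div_le_div_iff₀ (hpos n t ht) (hpos m t ht)]
    have h1 : (n : ℝ) ≤ m := by exact_mod_cast hnm
    nlinarith [hsp t ht, mul_le_mul_of_nonneg_right h1 (hsp t ht)]
  -- the kernel of `d` is the kernel of `c`
  set N := LinearMap.ker c.toLinearMap with hN
  have hNaff : IsAff M N := IsAff.ker hc
  have hker : ∀ n, ∀ ξ ∈ N, cfc (h n) d ξ = 0 := fun n ξ hξ => by
    have e : cfc (h n) d = cfc (fun t : ℝ => ((n : ℝ) / (1 + n * t)) * t) d :=
      cfc_congr fun t _ => by simp only [h]; ring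
    have e3 : ContinuousOn (fun t : ℝ => n / (1 + n * t)) (spectrum ℝ d) :=
      ContinuousOn.div (by fun_prop) (by fun_prop) fun t ht => (hpos n t ht).ne'
    rw [e, cfc_mul _ (fun t => t) d e3 continuousOn_id, cfc_id' ℝ d]
    have e2 : c ξ = 0 := hξ
    simp [hd, e2]
  have hconv : ∀ ζ : H, Tendsto (fun n => cfc (h n) d (d ζ)) atTop (𝓝 (d ζ)) := fun ζ => by
    rw [tendsto_iff_norm_sub_tendsto_zero]
    have hb : ∀ n : ℕ, 0 < n → ‖cfc (h n) d (d ζ) - d ζ‖ ≤ (1 / n : ℝ) * ‖ζ‖ := fun n hn => by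
      have e : cfc (h n) d * d - d = cfc (fun t => h n t * t - t) d := by
        rw [cfc_sub (fun t => h n t * t) (fun t => t) d ((hh n).mul continuousOn_id) continuousOn_id,
          cfc_mul (h n) (fun t => t) d (hh n) continuousOn_id, cfc_id' ℝ d]
      have e2 : cfc (h n) d (d ζ) - d ζ = (cfc (h n) d * d - d) ζ := rfl
      rw [e2, e]
      refine ContinuousLinearMap.le_of_opNorm_le _ (norm_cfc_le (by positivity) fun t ht => ?_) ζ
      have hn' : (0 : ℝ) < n := by exact_mod_cast hn
      have e4 : h n t * t - t = -(t / (1 + n * t)) := by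
        simp only [h]; field_simp [(hpos n t ht).ne']; ring
      rw [e4, norm_neg, Real.norm_of_nonneg (div_nonneg (hsp t ht) (hpos n t ht).le),
        div_le_div_iff₀ (hpos n t ht) hn']
      nlinarith [hsp t ht]
    have hl : Tendsto (fun n : ℕ => (1 / n : ℝ) * ‖ζ‖) atTop (𝓝 0) := by
      simpa using tendsto_one_div_atTop_nhds_zero_nat.mul_const ‖ζ‖
    exact squeeze_zero' (Eventually.of_forall fun _ => norm_nonneg _)
      (eventually_atTop.2 ⟨1, fun n hn => hb n hn⟩) hl
  have hnorm : ∀ n, ‖cfc (h n) d‖ ≤ 1 := fun n => by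
    refine norm_cfc_le zero_le_one fun t ht => ?_
    have h1 : 0 ≤ h n t := div_nonneg (mul_nonneg (Nat.cast_nonneg n) (hsp t ht)) (hpos n t ht).le
    rw [Real.norm_of_nonneg h1]
    simp only [h]
    rw [div_le_one (hpos n t ht)]; linarith
  have hconv2 : ∀ ξ ∈ Nᗮ, Tendsto (fun n => cfc (h n) d ξ) atTop (𝓝 ξ) := fun ξ hξ => by
    have hcl : ξ ∈ closure (Set.range d) := by
      have h1 : (LinearMap.range d.toLinearMap)ᗮ ≤ N := by
        intro u hu
        have h2 : inner ℂ (d u) u = 0 := by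
          rw [Submodule.mem_orthogonal] at hu
          exact hu _ ⟨u, rfl⟩
        rw [hd, inner_star_mul] at h2
        have h3 : ‖c u‖ ^ 2 = 0 := by exact_mod_cast h2
        exact norm_eq_zero.1 (by simpa using h3)
      have h2 := Submodule.orthogonal_le h1 hξ
      rw [Submodule.orthogonal_orthogonal_eq_closure] at h2
      exact h2
    rw [Metric.tendsto_atTop]
    intro ε hε
    obtain ⟨_, ⟨ζ, rfl⟩, hζ⟩ := Metric.mem_closure_iff.1 hcl (ε / 3) (by positivity)
    obtain ⟨n0, hn0⟩ := Metric.tendsto_atTop.1 (hconv ζ) (ε / 3) (by positivity)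
    refine ⟨n0, fun n hn => ?_⟩
    have h1 : dist (cfc (h n) d ξ) (cfc (h n) d (d ζ)) ≤ dist ξ (d ζ) := by
      rw [dist_eq_norm, dist_eq_norm, ← map_sub]
      simpa using ContinuousLinearMap.le_of_opNorm_le _ (hnorm n) (ξ - d ζ)
    have h2 := hn0 n hn
    have h3 := dist_triangle4 (cfc (h n) d ξ) (cfc (h n) d (d ζ)) (d ζ) ξ
    rw [dist_comm (d ζ) ξ] at h3
    linarith
  have hsup : τ.toFun (proj Nᗮ) = ⨆ n, τ.toFun (cfc (h n) d) := by
    refine trace_eq_iSup τ (fun n => cfc_mem hdM _) hh0 hmono hNaff.orthogonal.proj_mem fun ξ => ?_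
    have h1 : ∀ n, cfc (h n) d ξ = cfc (h n) d (proj Nᗮ ξ) := fun n => by
      rw [proj_orthogonal]
      simp [hker n _ (proj_mem hNaff.closed ξ)]
    simp only [h1]
    exact (hconv2 _ (proj_mem hNaff.orthogonal.closed ξ)).inner tendsto_const_nhds
  unfold dim
  rw [hsup]
  refine iSup_le fun n => ?_
  rw [← hvv n, τ.tracial _ (hvM n)]
  refine trace_mono τ (mul_mem (hvM n) (star_mem (hvM n))) hK.proj_mem (mul_star_self_nonneg _) ?_
  rw [le_iff_inner]
  intro ξ
  have hstar : star (v n) (proj K ξ) = star (v n) ξ := by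
    have : proj K * v n = v n := by
      ext η
      exact proj_eq_self (hcK _)
    have h2 := congrArg star this
    rw [star_mul, (proj_isSelfAdjoint K).star_eq] at h2
    exact congrArg (fun t : H →L[ℂ] H => t ξ) h2
  have h1 := inner_star_mul (star (v n)) ξ
  rw [star_star] at h1
  rw [h1, inner_proj]
  have h2 : ‖star (v n)‖ ≤ 1 := by
    rw [norm_star]
    have h3 := CStarRing.norm_star_mul_self (x := v n)
    rw [hvv n] at h3
    have h4 := hnorm n
    rw [h3] at h4
    nlinarith [norm_nonneg (v n)]
  have h3 : ‖star (v n) ξ‖ ≤ ‖proj K ξ‖ := by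
    rw [← hstar]
    simpa using ContinuousLinearMap.le_of_opNorm_le _ h2 (proj K ξ)
  exact_mod_cast pow_le_pow_left₀ (norm_nonneg _) h3 2

/-- If `L` meets the orthogonal complement of `K` trivially, then `L` is not larger than `K`. -/
theorem dim_le_of_disjoint {K L : Submodule ℂ H} (hK : IsAff M K) (hL : IsAff M L)
    (h : ∀ ξ ∈ L, ξ ∈ Kᗮ → ξ = 0) : dim τ L ≤ dim τ K := by
  have h1 := dim_ker_orthogonal_le (τ := τ) (c := proj K * proj L) (mul_mem hK.proj_mem hL.proj_mem) hK
    (fun ξ => proj_mem hK.closed _)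
  refine (dim_mono hL (IsAff.ker (mul_mem hK.proj_mem hL.proj_mem)).orthogonal ?_).trans h1
  refine (Submodule.le_orthogonal_orthogonal L).trans (Submodule.orthogonal_le ?_)
  intro ξ hξ
  have h2 : proj K (proj L ξ) = 0 := hξ
  exact mem_orthogonal_of_proj_eq_zero
    (h _ (proj_mem hL.closed ξ) (mem_orthogonal_of_proj_eq_zero h2))

theorem dim_add {A B : Submodule ℂ H} (hA : IsAff M A) (hB : IsAff M B) (h : A ≤ B) :
    dim τ B = dim τ A + dim τ (B ⊓ Aᗮ) := by
  unfold dim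
  rw [proj_add_proj hA.closed hB.closed h]
  exact τ.map_add _ _ hA.proj_mem (hB.inf hA.orthogonal).proj_mem (proj_nonneg _) (proj_nonneg _)

theorem dim_inf_orthogonal_le {K L : Submodule ℂ H} (hK : IsAff M K) (hL : IsAff M L) :
    dim τ (K ⊓ L)ᗮ ≤ dim τ Kᗮ + dim τ Lᗮ := by
  rw [dim_add hK.orthogonal (hK.inf hL).orthogonal (Submodule.orthogonal_le inf_le_left)]
  gcongr
  refine dim_le_of_disjoint hL.orthogonal ((hK.inf hL).orthogonal.inf hK.orthogonal.orthogonal) ?_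
  rintro ξ ⟨h1, h2⟩ h3
  have := hK.closed.completeSpace_coe
  have := hL.closed.completeSpace_coe
  rw [Submodule.orthogonal_orthogonal] at h2 h3
  exact inner_self_eq_zero.1 (Submodule.inner_right_of_mem_orthogonal (K := K ⊓ L) ⟨h2, h3⟩ h1)

/-- Cutting a subspace `L` down to `K` costs at most the codimension of `K`. -/
theorem dim_le_dim_inf_add {K L : Submodule ℂ H} (hK : IsAff M K) (hL : IsAff M L) :
    dim τ L ≤ dim τ (L ⊓ K) + dim τ Kᗮ := by
  rw [dim_add (hL.inf hK) hL inf_le_left]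
  gcongr
  refine dim_le_of_disjoint hK.orthogonal (hL.inf (hL.inf hK).orthogonal) ?_
  rintro ξ ⟨h1, h2⟩ h3
  have := hK.closed.completeSpace_coe
  rw [Submodule.orthogonal_orthogonal] at h3
  exact inner_self_eq_zero.1 (Submodule.inner_right_of_mem_orthogonal (K := L ⊓ K) ⟨h1, h3⟩ h2)

/-! ### `τ`-dense subspaces -/

/-- A subspace is `τ`-dense if it contains closed subspaces affiliated with `M` of arbitrarily small
codimension. -/
def TauDense (τ : NSFTrace M) (D : Submodule ℂ H) : Prop :=
  ∀ ε : ℝ≥0∞, 0 < ε → ∃ K, IsAff M K ∧ K ≤ D ∧ dim τ Kᗮ ≤ ε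

theorem TauDense.mono {D E : Submodule ℂ H} (hD : TauDense τ D) (h : D ≤ E) : TauDense τ E :=
  fun ε hε => (hD ε hε).imp fun _ hK => ⟨hK.1, hK.2.1.trans h, hK.2.2⟩

theorem TauDense.inf {D E : Submodule ℂ H} (hD : TauDense τ D) (hE : TauDense τ E) :
    TauDense τ (D ⊓ E) := by
  intro ε hε
  obtain ⟨K, hK, hKD, hK'⟩ := hD (ε / 2) (ENNReal.half_pos hε.ne')
  obtain ⟨L, hL, hLE, hL'⟩ := hE (ε / 2) (ENNReal.half_pos hε.ne')
  refine ⟨K ⊓ L, hK.inf hL, inf_le_inf hKD hLE, (dim_inf_orthogonal_le hK hL).trans ?_⟩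
  exact (add_le_add hK' hL').trans (ENNReal.add_halves ε).le

/-- The largest subspace of `D` spanned by closed subspaces affiliated with `M`. -/
noncomputable def affSpan (M : VonNeumannAlgebra H) (D : Submodule ℂ H) : Submodule ℂ H :=
  ⨆ K : {K : Submodule ℂ H // IsAff M K ∧ K ≤ D}, (K : Submodule ℂ H)

theorem affSpan_le (D : Submodule ℂ H) : affSpan M D ≤ D := iSup_le fun K => K.2.2

theorem le_affSpan {D K : Submodule ℂ H} (hK : IsAff M K) (h : K ≤ D) : K ≤ affSpan M D :=
  le_iSup (fun K : {K : Submodule ℂ H // IsAff M K ∧ K ≤ D} => (K : Submodule ℂ H)) ⟨K, hK, h⟩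

theorem affSpan_invariant (D : Submodule ℂ H) :
    ∀ y ∈ M.commutant, ∀ ξ ∈ affSpan M D, y ξ ∈ affSpan M D := by
  intro y hy
  have : affSpan M D ≤ (affSpan M D).comap y.toLinearMap :=
    iSup_le fun K ξ hξ => le_affSpan K.2.1 K.2.2 (K.2.1.map_mem y hy ξ hξ)
  exact fun ξ hξ => this hξ

/-- The projection onto the complement of a `τ`-dense subspace has arbitrarily small trace, so it is
zero because `τ` is faithful. -/
theorem TauDense.orthogonal_eq_bot {D : Submodule ℂ H} (hD : TauDense τ D) : Dᗮ = ⊥ := by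
  have haff : IsAff M (affSpan M D)ᗮ := IsAff.orthogonal_of_invariant (affSpan_invariant D)
  have h0 : dim τ (affSpan M D)ᗮ = 0 := by
    by_contra hne
    obtain ⟨ε, hε, hlt⟩ := exists_between (pos_iff_ne_zero.2 hne)
    obtain ⟨K, hK, hKD, hKε⟩ := hD ε hε
    exact absurd ((dim_mono haff hK.orthogonal
      (Submodule.orthogonal_le (le_affSpan hK hKD))).trans hKε) (not_le.2 hlt)
  rw [eq_bot_iff, ← eq_bot_of_dim_eq_zero haff h0]
  exact Submodule.orthogonal_le (affSpan_le D)

theorem TauDense.dense {D : Submodule ℂ H} (hD : TauDense τ D) : Dense (D : Set H) :=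
  Submodule.dense_iff_topologicalClosure_eq_top.2
    ((Submodule.topologicalClosure_eq_top_iff).2 hD.orthogonal_eq_bot)

end NCLp

namespace NCLp

variable {H : Type*} [NormedAddCommGroup H] [InnerProductSpace ℂ H] [CompleteSpace H]
  {M : VonNeumannAlgebra H}

open Filter Topology

/-! ### Spectral subspaces of a bounded selfadjoint operator -/

theorem cfc_mul_apply {f g : ℝ → ℝ} (hf : Continuous f) (hg : Continuous g) (s : H →L[ℂ] H) (ξ : H) :
    cfc f s (cfc g s ξ) = cfc (fun t => f t * g t) s ξ := by
  rw [cfc_mul f g s hf.continuousOn hg.continuousOn]; rfl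

theorem cfc_sub_apply {f g : ℝ → ℝ} (hf : Continuous f) (hg : Continuous g) (s : H →L[ℂ] H) (ξ : H) :
    cfc (fun t => f t - g t) s ξ = cfc f s ξ - cfc g s ξ := by
  rw [cfc_sub f g s hf.continuousOn hg.continuousOn]; rfl

theorem inner_cfc (f : ℝ → ℝ) (s : H →L[ℂ] H) (ξ η : H) :
    inner ℂ (cfc f s ξ) η = inner ℂ ξ (cfc f s η) :=
  inner_isSelfAdjoint (cfc_isSelfAdjoint f s) ξ η

/-- The range of the spectral projection of the selfadjoint operator `s` for the interval `[δ, ∞)`: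
the vectors annihilated by `g(s)` for every continuous `g` that vanishes on `[δ, ∞)`. -/
def specSub (s : H →L[ℂ] H) (δ : ℝ) : Submodule ℂ H where
  carrier := {ξ | ∀ g : ℝ → ℝ, Continuous g → (∀ t, δ ≤ t → g t = 0) → cfc g s ξ = 0}
  add_mem' ha hb g hg h0 := by rw [map_add, ha g hg h0, hb g hg h0, add_zero]
  zero_mem' g _ _ := map_zero _
  smul_mem' c ξ hξ g hg h0 := by rw [map_smul, hξ g hg h0, smul_zero]

variable {s : H →L[ℂ] H} {δ : ℝ}

theorem isClosed_specSub (s : H →L[ℂ] H) (δ : ℝ) : IsClosed (specSub s δ : Set H) := by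
  have : (specSub s δ : Set H) = ⋂ (g : ℝ → ℝ) (_ : Continuous g) (_ : ∀ t, δ ≤ t → g t = 0),
      {ξ | cfc g s ξ = 0} := by
    ext ξ; simp [specSub]
  rw [this]
  exact isClosed_iInter fun g => isClosed_iInter fun _ => isClosed_iInter fun _ =>
    isClosed_eq (cfc g s).continuous continuous_const

theorem specSub_isAff (hs : s ∈ M) (δ : ℝ) : IsAff M (specSub s δ) where
  closed := isClosed_specSub s δ
  map_mem y hy ξ hξ g hg h0 := by
    rw [← mem_iff_commutant.1 (cfc_mem hs g) y hy, hξ g hg h0, map_zero]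

theorem specSub_anti (s : H →L[ℂ] H) {δ δ' : ℝ} (h : δ ≤ δ') : specSub s δ' ≤ specSub s δ :=
  fun _ hξ g hg h0 => hξ g hg fun t ht => h0 t (h.trans ht)

theorem cfc_apply_mem_specSub {ξ : H} {f : ℝ → ℝ} (hf : Continuous f) (hξ : ξ ∈ specSub s δ) :
    cfc f s ξ ∈ specSub s δ := by
  intro g hg h0
  rw [cfc_mul_apply hg hf]
  exact hξ _ (hg.mul hf) fun t ht => by simp [h0 t ht]

theorem cfc_apply_mem_specSub_orthogonal {ξ : H} {f : ℝ → ℝ} (hf : Continuous f)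
    (hξ : ξ ∈ (specSub s δ)ᗮ) : cfc f s ξ ∈ (specSub s δ)ᗮ := by
  rw [Submodule.mem_orthogonal] at hξ ⊢
  intro u hu
  rw [← inner_cfc]
  exact hξ _ (cfc_apply_mem_specSub hf hu)

theorem proj_specSub_cfc {f : ℝ → ℝ} (hf : Continuous f) (ξ : H) :
    proj (specSub s δ) (cfc f s ξ) = cfc f s (proj (specSub s δ) ξ) := by
  refine eq_proj (cfc_apply_mem_specSub hf (proj_mem (isClosed_specSub s δ) ξ)) ?_
  rw [← map_sub]
  exact cfc_apply_mem_specSub_orthogonal hf (sub_proj_mem _ ξ)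

theorem cfc_apply_congr {ξ : H} (hξ : ξ ∈ specSub s δ) {f g : ℝ → ℝ} (hf : Continuous f)
    (hg : Continuous g) (h : ∀ t, δ ≤ t → f t = g t) : cfc f s ξ = cfc g s ξ := by
  rw [← sub_eq_zero, ← cfc_sub_apply hf hg]
  exact hξ _ (hf.sub hg) fun t ht => sub_eq_zero.2 (h t ht)

theorem cfc_apply_congr_orthogonal {ξ : H} (hξ : ξ ∈ (specSub s δ)ᗮ) {f g : ℝ → ℝ}
    (hf : Continuous f) (hg : Continuous g) (h : ∀ t, t ≤ δ → f t = g t) :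
    cfc f s ξ = cfc g s ξ := by
  rw [← sub_eq_zero, ← cfc_sub_apply hf hg]
  have h1 : cfc (fun t => f t - g t) s ξ ∈ specSub s δ := by
    intro k hk h0
    rw [cfc_mul_apply hk (show Continuous fun t => f t - g t from hf.sub hg)]
    have : (fun t => k t * (f t - g t)) = fun _ => 0 := by
      funext t
      rcases le_total t δ with ht | ht
      · simp [h t ht]
      · simp [h0 t ht]
    rw [this, cfc_const_zero]; rfl
  have h2 := cfc_apply_mem_specSub_orthogonal (s := s) (hf.sub hg) hξ
  exact inner_self_eq_zero.1 (Submodule.inner_right_of_mem_orthogonal h1 h2)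

theorem re_inner_cfc_mono {f g : ℝ → ℝ} (hf : Continuous f)
    (hg : Continuous g) (h : ∀ t, f t ≤ g t) (ξ : H) :
    (inner ℂ (cfc f s ξ) ξ).re ≤ (inner ℂ (cfc g s ξ) ξ).re :=
  (Complex.le_def.1 (le_iff_inner.1
    (cfc_mono (fun t _ => h t) hf.continuousOn hg.continuousOn) ξ)).1

theorem inner_cfc_const (hs : IsSelfAdjoint s) (C : ℝ) (ξ : H) :
    (inner ℂ (cfc (fun _ => C) s ξ) ξ).re = C * ‖ξ‖ ^ 2 := by
  rw [cfc_const C s, Algebra.algebraMap_eq_smul_one]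
  have : (C • (1 : H →L[ℂ] H)) ξ = (C : ℂ) • ξ := by simp
  rw [this, inner_smul_left, inner_self_complex, Complex.conj_ofReal, ← Complex.ofReal_mul,
    Complex.ofReal_re]

theorem re_inner_cfc_le (hs : IsSelfAdjoint s) {ξ : H} (hξ : ξ ∈ specSub s δ) {f : ℝ → ℝ}
    (hf : Continuous f) {C : ℝ} (h : ∀ t, δ ≤ t → f t ≤ C) :
    (inner ℂ (cfc f s ξ) ξ).re ≤ C * ‖ξ‖ ^ 2 := by
  rw [cfc_apply_congr hξ hf (g := fun t => f (max t δ)) (by fun_prop)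
    (fun t ht => by simp [max_eq_left ht]), ← inner_cfc_const hs]
  exact re_inner_cfc_mono (by fun_prop) continuous_const (fun t => h _ (le_max_right _ _)) ξ

theorem le_re_inner_cfc_orthogonal (hs : IsSelfAdjoint s) {ξ : H} (hξ : ξ ∈ (specSub s δ)ᗮ)
    {f : ℝ → ℝ} (hf : Continuous f) {C : ℝ} (h : ∀ t, t ≤ δ → C ≤ f t) :
    C * ‖ξ‖ ^ 2 ≤ (inner ℂ (cfc f s ξ) ξ).re := by
  rw [cfc_apply_congr_orthogonal hξ hf (g := fun t => f (min t δ)) (by fun_prop)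
    (fun t ht => by simp [min_eq_left ht]), ← inner_cfc_const hs]
  exact re_inner_cfc_mono continuous_const (by fun_prop) (fun t => h _ (min_le_right _ _)) ξ

theorem re_inner_le_orthogonal (hs : IsSelfAdjoint s) {ξ : H} (hξ : ξ ∈ (specSub s δ)ᗮ) :
    (inner ℂ (s ξ) ξ).re ≤ δ * ‖ξ‖ ^ 2 := by
  have h := le_re_inner_cfc_orthogonal hs hξ (f := fun t => -t) (by fun_prop) (C := -δ)
    (fun t ht => by linarith)
  rw [cfc_neg_id s] at h
  simp only [neg_apply, inner_neg_left, Complex.neg_re] at h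
  linarith

/-- The spectral subspaces of an injective positive operator exhaust the space. -/
theorem tendsto_proj_specSub (hs : 0 ≤ s) (hinj : ∀ ξ, s ξ = 0 → ξ = 0) {δ : ℕ → ℝ}
    (hanti : Antitone δ) (hδ : Tendsto δ atTop (𝓝 0)) (ξ : H) :
    Tendsto (fun n => proj (specSub s (δ n)) ξ) atTop (𝓝 ξ) := by
  refine Submodule.starProjection_tendsto_self (fun n => (specSub s (δ n)).topologicalClosure)
    (fun m n hmn => Submodule.topologicalClosure_mono (specSub_anti s (hanti hmn))) ξ ?_
  rw [top_le_iff, Submodule.topologicalClosure_eq_top_iff, eq_bot_iff]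
  intro η hη
  have hsa := hs.isSelfAdjoint
  have h1 : ∀ n, (inner ℂ (s η) η).re ≤ δ n * ‖η‖ ^ 2 := fun n => by
    refine re_inner_le_orthogonal hsa (Submodule.orthogonal_le ?_ hη)
    exact (Submodule.le_topologicalClosure _).trans
      (le_iSup (fun n => (specSub s (δ n)).topologicalClosure) n)
  have h2 : (inner ℂ (s η) η).re ≤ 0 := by
    refine ge_of_tendsto (x := atTop) (f := fun n => δ n * ‖η‖ ^ 2) ?_ (Eventually.of_forall h1)
    simpa using hδ.mul_const (‖η‖ ^ 2)
  have h3 : inner ℂ (s η) η = 0 := by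
    rw [inner_real_of_nonneg hs]
    have := (Complex.nonneg_iff.1 (nonneg_iff_inner.1 hs η)).1
    simp [le_antisymm h2 this]
  have h4 : CFC.sqrt s η = 0 := by
    have h5 : inner ℂ (CFC.sqrt s η) (CFC.sqrt s η) = 0 := by
      rw [← inner_isSelfAdjoint (CFC.sqrt_nonneg s).isSelfAdjoint]
      have := CFC.sqrt_mul_sqrt_self s hs
      rw [← h3]
      exact congrArg (fun t : H →L[ℂ] H => inner ℂ (t η) η) this
    exact inner_self_eq_zero.1 h5
  refine hinj η ?_
  have := congrArg (fun t : H →L[ℂ] H => t η) (CFC.sqrt_mul_sqrt_self s hs)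
  rw [← this]
  change CFC.sqrt s (CFC.sqrt s η) = 0
  rw [h4, map_zero]

end NCLp

namespace NCLp

variable {H : Type*} [NormedAddCommGroup H] [InnerProductSpace ℂ H] [CompleteSpace H]
  {M : VonNeumannAlgebra H} {τ : NSFTrace M}

open Filter Topology

/-! ### Projections onto graphs -/

/-- The first column, upper entry, of the orthogonal projection onto a subspace of `H ⊕ H`. -/
noncomputable def cornerFst (G : Submodule ℂ (WithLp 2 (H × H))) [G.HasOrthogonalProjection] :
    H →L[ℂ] H :=
  (WithLp.fstL 2 ℂ H H) ∘L G.starProjection ∘L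
    (WithLp.prodContinuousLinearEquiv 2 ℂ H H).symm.toContinuousLinearMap ∘L
    ContinuousLinearMap.inl ℂ H H

/-- The first column, lower entry, of the orthogonal projection onto a subspace of `H ⊕ H`. -/
noncomputable def cornerSnd (G : Submodule ℂ (WithLp 2 (H × H))) [G.HasOrthogonalProjection] :
    H →L[ℂ] H :=
  (WithLp.sndL 2 ℂ H H) ∘L G.starProjection ∘L
    (WithLp.prodContinuousLinearEquiv 2 ℂ H H).symm.toContinuousLinearMap ∘L
    ContinuousLinearMap.inl ℂ H H

section corner

variable (G : Submodule ℂ (WithLp 2 (H × H))) [G.HasOrthogonalProjection]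

theorem corner_mem (ξ : H) : WithLp.toLp 2 (cornerFst G ξ, cornerSnd G ξ) ∈ G :=
  G.starProjection_apply_mem (WithLp.toLp 2 (ξ, 0))

theorem inner_corner (ξ : H) {v : WithLp 2 (H × H)} (hv : v ∈ G) :
    inner ℂ (ξ - cornerFst G ξ) v.fst = inner ℂ (cornerSnd G ξ) v.snd := by
  have h := G.starProjection_inner_eq_zero (WithLp.toLp 2 (ξ, 0)) v hv
  rw [WithLp.prod_inner_apply] at h
  have h1 : (WithLp.toLp 2 (ξ, (0 : H)) - G.starProjection (WithLp.toLp 2 (ξ, 0))).ofLp.fst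
      = ξ - cornerFst G ξ := rfl
  have h2 : (WithLp.toLp 2 (ξ, (0 : H)) - G.starProjection (WithLp.toLp 2 (ξ, 0))).ofLp.snd
      = 0 - cornerSnd G ξ := rfl
  rw [h1, h2, zero_sub, inner_neg_left, ← sub_eq_add_neg, sub_eq_zero] at h
  exact h

theorem corner_unique {ξ u w : H} (hm : WithLp.toLp 2 (u, w) ∈ G)
    (h : ∀ v ∈ G, inner ℂ (ξ - u) v.fst = inner ℂ w v.snd) :
    cornerFst G ξ = u ∧ cornerSnd G ξ = w := by
  have h1 : G.starProjection (WithLp.toLp 2 (ξ, 0)) = WithLp.toLp 2 (u, w) := by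
    refine (Submodule.eq_starProjection_of_mem_of_inner_eq_zero hm fun v hv => ?_)
    rw [WithLp.prod_inner_apply]
    have h2 := h v hv
    change inner ℂ (ξ - u) v.fst + inner ℂ ((0 : H) - w) v.snd = 0
    rw [h2, zero_sub, inner_neg_left, add_neg_cancel]
  constructor
  · change (G.starProjection (WithLp.toLp 2 (ξ, 0))).fst = u
    rw [h1]; rfl
  · change (G.starProjection (WithLp.toLp 2 (ξ, 0))).snd = w
    rw [h1]; rfl

theorem norm_sq_corner (ξ : H) :
    ((‖cornerFst G ξ‖ ^ 2 + ‖cornerSnd G ξ‖ ^ 2 : ℝ) : ℂ) = inner ℂ (cornerFst G ξ) ξ := by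
  have h := inner_corner G ξ (corner_mem G ξ)
  change inner ℂ (ξ - cornerFst G ξ) (cornerFst G ξ) = inner ℂ (cornerSnd G ξ) (cornerSnd G ξ) at h
  rw [inner_sub_left, inner_self_complex, inner_self_complex, sub_eq_iff_eq_add] at h
  rw [← inner_conj_symm, h]
  simp [add_comm]

theorem cornerFst_isSelfAdjoint : IsSelfAdjoint (cornerFst G) := by
  refine isSelfAdjoint_of_inner fun ξ η => ?_
  have h := inner_corner G ξ (corner_mem G η)
  have h' := inner_corner G η (corner_mem G ξ)
  change inner ℂ (ξ - cornerFst G ξ) (cornerFst G η) = inner ℂ (cornerSnd G ξ) (cornerSnd G η) at h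
  change inner ℂ (η - cornerFst G η) (cornerFst G ξ) = inner ℂ (cornerSnd G η) (cornerSnd G ξ) at h'
  have h2 := congrArg (starRingEnd ℂ) h'
  rw [inner_conj_symm, inner_conj_symm] at h2
  rw [← h, inner_sub_right, inner_sub_left] at h2
  exact sub_left_injective h2

theorem cornerFst_nonneg : 0 ≤ cornerFst G := by
  rw [nonneg_iff_inner]
  intro ξ
  rw [← norm_sq_corner]
  exact Complex.zero_le_real.2 (by positivity)

/-- The corners belong to `M` if the subspace is invariant under the commutant of `M`. -/
theorem corner_mem_algebra (hG : ∀ y ∈ M.commutant, ∀ v ∈ G, WithLp.toLp 2 (y v.fst, y v.snd) ∈ G) :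
    cornerFst G ∈ M ∧ cornerSnd G ∈ M := by
  have key : ∀ y ∈ M.commutant, ∀ ξ, cornerFst G (y ξ) = y (cornerFst G ξ) ∧
      cornerSnd G (y ξ) = y (cornerSnd G ξ) := by
    intro y hy ξ
    refine corner_unique G (hG y hy _ (corner_mem G ξ)) fun v hv => ?_
    have h := inner_corner G ξ (hG (star y) (star_mem hy) v hv)
    rw [← map_sub, ← inner_star_right, ← inner_star_right]
    exact h
  exact ⟨mem_iff_commutant.2 fun y hy ξ => ((key y hy ξ).1).symm,
    mem_iff_commutant.2 fun y hy ξ => ((key y hy ξ).2).symm⟩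

end corner

variable {x y : H →ₗ.[ℂ] H}

theorem mem_hilbertGraph (hx : x.IsClosed) {v : WithLp 2 (H × H)} :
    v ∈ hilbertGraph x ↔ (v.fst, v.snd) ∈ x.graph := by
  have hcl : IsClosed ((x.graph.comap (WithLp.linearEquiv 2 ℂ (H × H)).toLinearMap :
      Submodule ℂ (WithLp 2 (H × H))) : Set (WithLp 2 (H × H))) := by
    have h1 : IsClosed (x.graph : Set (H × H)) := hx
    exact h1.preimage (WithLp.prod_continuous_ofLp 2 H H)
  unfold hilbertGraph
  rw [hcl.submodule_topologicalClosure_eq]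
  rfl

/-- The operator `x (1 + x* x)⁻¹`, for `x` closed and densely defined. -/
noncomputable def mulInv (x : H →ₗ.[ℂ] H) : H →L[ℂ] H := cornerSnd (hilbertGraph x)

theorem invOneAddAbsSq_eq : invOneAddAbsSq x = cornerFst (hilbertGraph x) := rfl

theorem inv_mem_graph (hx : x.IsClosed) (ξ : H) : (invOneAddAbsSq x ξ, mulInv x ξ) ∈ x.graph :=
  (mem_hilbertGraph hx).1 (corner_mem (hilbertGraph x) ξ)

theorem inner_sub_inv (hx : x.IsClosed) (ξ : H) {v : H × H} (hv : v ∈ x.graph) :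
    inner ℂ (ξ - invOneAddAbsSq x ξ) v.1 = inner ℂ (mulInv x ξ) v.2 :=
  inner_corner (hilbertGraph x) ξ (v := WithLp.toLp 2 v) ((mem_hilbertGraph hx).2 hv)

/-- The pair `(s ξ, x s ξ)` is characterized as the orthogonal projection of `(ξ, 0)` onto the graph
of `x`. -/
theorem inv_unique (hx : x.IsClosed) {ξ u w : H} (hm : (u, w) ∈ x.graph)
    (h : ∀ v ∈ x.graph, inner ℂ (ξ - u) v.1 = inner ℂ w v.2) :
    invOneAddAbsSq x ξ = u ∧ mulInv x ξ = w :=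
  corner_unique (hilbertGraph x) ((mem_hilbertGraph hx).2 hm)
    fun v hv => h (v.fst, v.snd) ((mem_hilbertGraph hx).1 hv)

theorem IsAffiliated.map_mem (hx : IsAffiliated M x) {y : H →L[ℂ] H} (hy : y ∈ M.commutant)
    {v : H × H} (hv : v ∈ x.graph) : (y v.1, y v.2) ∈ x.graph := by
  obtain ⟨ξ, h1, h2⟩ := x.mem_graph_iff.1 hv
  rw [← h1, ← h2]
  exact hx y hy ξ

theorem inv_mem (hx : x.IsClosed) (ha : IsAffiliated M x) :
    invOneAddAbsSq x ∈ M ∧ mulInv x ∈ M :=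
  corner_mem_algebra _ fun _ hy _ hv =>
    (mem_hilbertGraph hx).2 (ha.map_mem hy ((mem_hilbertGraph hx).1 hv))

theorem inv_injective (hx : x.IsClosed) (hd : Dense (x.domain : Set H)) {ξ : H}
    (h : invOneAddAbsSq x ξ = 0) : ξ = 0 := by
  have h1 := norm_sq_corner (hilbertGraph x) ξ
  rw [← invOneAddAbsSq_eq, h, inner_zero_left] at h1
  have h2 : mulInv x ξ = 0 := by
    have h3 : ‖(0 : H)‖ ^ 2 + ‖cornerSnd (hilbertGraph x) ξ‖ ^ 2 = 0 := by exact_mod_cast h1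
    have h4 : cornerSnd (hilbertGraph x) ξ = 0 := by simpa using h3
    exact h4
  refine hd.eq_zero_of_inner_left (𝕜 := ℂ) fun v hv => ?_
  have h4 := inner_sub_inv hx ξ (x.mem_graph ⟨v, hv⟩)
  rw [h, h2, inner_zero_left, sub_zero] at h4
  exact h4

/-! ### Cores of measurable operators -/

/-- For a closed operator affiliated with `M`, the intersection of the domain with a `τ`-dense
subspace is a core. Let `R` be the orthogonal complement of the restricted graph in the full graph,
and `c` the upper left corner of the projection onto `R`. A nonzero vector in the range of `c` cannot
lie in a subspace `K` of the `τ`-dense subspace, so the support of `c` is at most as large as the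
complement of `K`. Hence `c = 0`, and `R = 0`. -/
theorem graph_le_closure_of_tauDense (hx : x.IsClosed) (ha : IsAffiliated M x) {D : Submodule ℂ H}
    (hD : TauDense τ D) :
    x.graph ≤ (x.graph ⊓ D.comap (LinearMap.fst ℂ H H)).topologicalClosure := by
  set D' := affSpan M D with hD'
  let W := WithLp 2 (H × H)
  let G0 : Submodule ℂ W := hilbertGraph x ⊓ D'.comap (WithLp.fstL 2 ℂ H H).toLinearMap
  let R : Submodule ℂ W := hilbertGraph x ⊓ G0ᗮ
  have hRcl : IsClosed (R : Set W) :=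
    (Submodule.isClosed_topologicalClosure _).inter (Submodule.isClosed_orthogonal _)
  have : CompleteSpace R := hRcl.completeSpace_coe
  have hG0inv : ∀ y ∈ M.commutant, ∀ v ∈ G0, WithLp.toLp 2 (y v.fst, y v.snd) ∈ G0 := by
    intro y hy v hv
    exact ⟨(mem_hilbertGraph hx).2 (ha.map_mem hy ((mem_hilbertGraph hx).1 hv.1)),
      affSpan_invariant D y hy _ hv.2⟩
  have hRinv : ∀ y ∈ M.commutant, ∀ v ∈ R, WithLp.toLp 2 (y v.fst, y v.snd) ∈ R := by
    intro y hy v hv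
    refine ⟨(mem_hilbertGraph hx).2 (ha.map_mem hy ((mem_hilbertGraph hx).1 hv.1)), ?_⟩
    rw [SetLike.mem_coe, Submodule.mem_orthogonal']
    intro u hu
    have h1 := (Submodule.mem_orthogonal' _ _).1 hv.2 _ (hG0inv (star y) (star_mem hy) u hu)
    rw [WithLp.prod_inner_apply] at h1 ⊢
    change inner ℂ v.fst (star y u.fst) + inner ℂ v.snd (star y u.snd) = 0 at h1
    rw [inner_star_right, inner_star_right] at h1
    exact h1
  have hRM := (corner_mem_algebra R hRinv).1
  set c := cornerFst R with hc
  have hdim : dim τ (LinearMap.ker c.toLinearMap)ᗮ = 0 := by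
    by_contra hne
    obtain ⟨ε, hε, hlt⟩ := exists_between (pos_iff_ne_zero.2 hne)
    obtain ⟨K, hK, hKD, hKε⟩ := hD ε hε
    refine absurd (le_trans ?_ hKε) (not_le.2 hlt)
    have h1 := dim_ker_orthogonal_le (τ := τ) (c := proj Kᗮ * c)
      (mul_mem hK.orthogonal.proj_mem hRM) hK.orthogonal
      (fun ξ => proj_mem hK.orthogonal.closed _)
    have h2 : LinearMap.ker (proj Kᗮ * c).toLinearMap = LinearMap.ker c.toLinearMap := by
      refine le_antisymm (fun ξ hξ => ?_) fun ξ hξ => ?_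
      · have h3 : proj Kᗮ (c ξ) = 0 := hξ
        have h4 : c ξ ∈ K := by
          rw [proj_orthogonal] at h3
          have h5 : c ξ - proj K (c ξ) = 0 := h3
          rw [sub_eq_zero] at h5
          rw [h5]; exact proj_mem hK.closed _
        have h6 : WithLp.toLp 2 (cornerFst R ξ, cornerSnd R ξ) ∈ R := corner_mem R ξ
        have h7 : WithLp.toLp 2 (cornerFst R ξ, cornerSnd R ξ) ∈ G0 :=
          ⟨h6.1, le_affSpan hK hKD h4⟩
        have h8 := inner_self_eq_zero.1 (Submodule.inner_right_of_mem_orthogonal h7 h6.2)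
        exact congrArg (fun v : W => v.fst) h8
      · have h3 : c ξ = 0 := hξ
        change proj Kᗮ (c ξ) = 0
        rw [h3, map_zero]
    rwa [h2] at h1
  have hc0 : ∀ ξ, c ξ = 0 := fun ξ => by
    have h1 := eq_bot_of_dim_eq_zero (IsAff.ker hRM).orthogonal hdim
    have h2 : IsClosed (LinearMap.ker c.toLinearMap : Set H) := (IsAff.ker hRM).closed
    have := h2.completeSpace_coe
    rw [Submodule.orthogonal_eq_bot_iff] at h1
    have : ξ ∈ LinearMap.ker c.toLinearMap := by rw [h1]; trivial
    exact this
  have hR0 : ∀ v ∈ R, v = 0 := fun v hv => by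
    have h1 : v.fst = 0 := by
      have h2 := inner_corner R v.fst hv
      have h3 := norm_sq_corner R v.fst
      rw [← hc, hc0, inner_zero_left] at h3
      have h4 : cornerSnd R v.fst = 0 := by
        have h5 : ‖(0 : H)‖ ^ 2 + ‖cornerSnd R v.fst‖ ^ 2 = 0 := by exact_mod_cast h3
        simpa using h5
      rw [← hc, hc0, h4, inner_zero_left, sub_zero] at h2
      exact inner_self_eq_zero.1 h2
    have h2 := (mem_hilbertGraph hx).1 hv.1
    have h3 : v.snd = 0 := by
      rw [h1] at h2
      exact x.graph_fst_eq_zero_snd h2 rfl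
    exact WithLp.ofLp_injective 2 (Prod.ext h1 h3)
  have hle : hilbertGraph x ≤ G0.topologicalClosure := by
    intro v hv
    have h1 : v - G0.topologicalClosure.starProjection v ∈ G0.topologicalClosureᗮ :=
      Submodule.sub_starProjection_mem_orthogonal v
    have h3 : G0.topologicalClosure ≤ hilbertGraph x :=
      Submodule.topologicalClosure_minimal _ inf_le_left (Submodule.isClosed_topologicalClosure _)
    have h2 := hR0 _ ⟨Submodule.sub_mem _ hv (h3 (G0.topologicalClosure.starProjection_apply_mem v)),
      by rwa [Submodule.orthogonal_closure] at h1⟩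
    rw [sub_eq_zero] at h2
    rw [h2]; exact G0.topologicalClosure.starProjection_apply_mem v
  intro v hv
  have h1 := hle ((mem_hilbertGraph hx (v := WithLp.toLp 2 v)).2 hv)
  have h2 : v ∈ closure (WithLp.ofLp '' (G0 : Set W)) :=
    image_closure_subset_closure_image (WithLp.prod_continuous_ofLp 2 H H) ⟨_, h1, rfl⟩
  refine closure_mono ?_ h2
  rintro _ ⟨u, hu, rfl⟩
  exact ⟨(mem_hilbertGraph hx).1 hu.1, affSpan_le D hu.2⟩

/-- Closed operators affiliated with `M` that agree on a `τ`-dense subspace are equal. -/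
theorem eq_of_agree (hx : x.IsClosed) (hxa : IsAffiliated M x) (hy : y.IsClosed)
    (hya : IsAffiliated M y) {D : Submodule ℂ H} (hD : TauDense τ D)
    (h : ∀ ξ ∈ D, ∃ η, (ξ, η) ∈ x.graph ∧ (ξ, η) ∈ y.graph) : x = y := by
  have key : ∀ {x y : H →ₗ.[ℂ] H}, x.IsClosed → IsAffiliated M x → y.IsClosed →
      (∀ ξ ∈ D, ∃ η, (ξ, η) ∈ x.graph ∧ (ξ, η) ∈ y.graph) → x.graph ≤ y.graph := by
    intro x y hx hxa hy h
    refine (graph_le_closure_of_tauDense hx hxa hD).trans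
      (Submodule.topologicalClosure_minimal _ ?_ hy)
    rintro ⟨ξ, ζ⟩ ⟨h1, h2⟩
    obtain ⟨η, h3, h4⟩ := h ξ h2
    have : ζ = η := x.mem_graph_snd_inj h1 h3 rfl
    rw [this]; exact h4
  exact LinearPMap.eq_of_eq_graph (le_antisymm (key hx hxa hy h)
    (key hy hya hx fun ξ hξ => (h ξ hξ).imp fun _ h => h.symm))

/-! ### Symmetric measurable operators -/

/-- `⟨x ξ, η⟩ = ⟨ξ, x η⟩` for all `ξ`, `η` in the domain of `x`. -/
def IsSymm (x : H →ₗ.[ℂ] H) : Prop :=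
  ∀ u ∈ x.graph, ∀ v ∈ x.graph, inner ℂ (u : H × H).2 (v : H × H).1 = inner ℂ u.1 v.2

theorem isPos_iff_graph : IsPos x ↔ ∀ v ∈ x.graph, 0 ≤ inner ℂ (v : H × H).2 v.1 := by
  constructor
  · intro h v hv
    obtain ⟨ξ, h1, h2⟩ := x.mem_graph_iff.1 hv
    rw [← h1, ← h2]; exact h ξ
  · exact fun h ξ => h _ (x.mem_graph ξ)

theorem IsPos.isSymm (hx : IsPos x) : IsSymm x := by
  rw [isPos_iff_graph] at hx
  have h0 : ∀ v ∈ x.graph, inner ℂ (v : H × H).2 v.1 = inner ℂ v.1 v.2 := fun v hv => by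
    have h := (Complex.nonneg_iff.1 (hx v hv)).2
    rw [← inner_conj_symm v.1 v.2]
    exact (Complex.conj_eq_iff_im.2 h.symm).symm
  intro u hu v hv
  have h1 := h0 _ (x.graph.add_mem hu hv)
  have h2 := h0 _ (x.graph.add_mem hu (x.graph.smul_mem Complex.I hv))
  simp only [Prod.fst_add, Prod.snd_add, Prod.smul_fst, Prod.smul_snd, inner_add_left,
    inner_add_right, inner_smul_left, inner_smul_right, Complex.conj_I, h0 u hu, h0 v hv] at h1 h2
  have h3 : inner ℂ v.2 u.1 + inner ℂ u.2 v.1 = inner ℂ u.1 v.2 + inner ℂ v.1 u.2 := by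
    linear_combination h1
  have h4 : Complex.I * (inner ℂ u.2 v.1 - inner ℂ v.2 u.1) =
      Complex.I * (inner ℂ u.1 v.2 - inner ℂ v.1 u.2) := by
    linear_combination h2
  have h5 := mul_left_cancel₀ Complex.I_ne_zero h4
  linear_combination (h3 + h5) / 2

/-- The selfadjoint part of `L₀(M, τ)`: the closed symmetric operators affiliated with `M` with
`τ`-dense domain. -/
structure L0sa (τ : NSFTrace M) (x : H →ₗ.[ℂ] H) : Prop where
  closed : x.IsClosed
  affiliated : IsAffiliated M x
  tauDense : TauDense τ x.domain
  symm : IsSymm x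

theorem L0sa.dense (hx : L0sa τ x) : Dense (x.domain : Set H) := hx.tauDense.dense

theorem MemL0.tauDense (hx : MemL0 τ x) : TauDense τ x.domain := by
  intro ε hε
  obtain ⟨e, heM, he, hτ, b, -, hb⟩ := hx.measurable ε hε
  obtain ⟨K, hK, rfl⟩ := IsAff.of_isStarProjection he heM
  refine ⟨K, hK, fun ξ hξ => ?_, ?_⟩
  · have h1 := LinearPMap.mem_domain_of_mem_graph (hb ξ)
    rwa [proj_eq_self hξ] at h1
  · unfold dim
    rwa [proj_orthogonal]

theorem MemL0.l0sa (hx : MemL0 τ x) (h : IsPos x) : L0sa τ x :=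
  ⟨hx.closed, hx.affiliated, hx.tauDense, h.isSymm⟩

/-- By the closed graph theorem, a closed affiliated operator is bounded on every closed affiliated
subspace of its domain. -/
theorem exists_isMulBounded (hx : x.IsClosed) (ha : IsAffiliated M x) {K : Submodule ℂ H}
    (hK : IsAff M K) (hKx : K ≤ x.domain) : ∃ b ∈ M, IsMulBounded x (proj K) b := by
  let f : H →ₗ[ℂ] H := x.toFun.comp
    ((proj K).toLinearMap.codRestrict x.domain fun ξ => hKx (proj_mem hK.closed ξ))
  have hf : ∀ ξ, (proj K ξ, f ξ) ∈ x.graph := fun ξ =>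
    x.mem_graph ⟨proj K ξ, hKx (proj_mem hK.closed ξ)⟩
  have hfcl : IsClosed (f.graph : Set (H × H)) := by
    have h1 : IsClosed (x.graph : Set (H × H)) := hx
    have h2 : (f.graph : Set (H × H)) = (fun v : H × H => (proj K v.1, v.2)) ⁻¹' x.graph := by
      ext v
      simp only [SetLike.mem_coe, LinearMap.mem_graph_iff, Set.mem_preimage]
      constructor
      · intro h; rw [h]; exact hf _
      · intro h; exact x.mem_graph_snd_inj h (hf v.1) rfl
    rw [h2]
    exact h1.preimage (by fun_prop)
  refine ⟨ContinuousLinearMap.ofIsClosedGraph hfcl, ?_, hf⟩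
  rw [mem_iff_commutant]
  intro y hy ξ
  have h1 := ha.map_mem hy (hf ξ)
  have h2 := mem_iff_commutant.1 hK.proj_mem y hy ξ
  exact x.mem_graph_snd_inj h1 (hf (y ξ)) h2

theorem L0sa.memL0 (hx : L0sa τ x) : MemL0 τ x where
  dense := hx.dense
  closed := hx.closed
  affiliated := hx.affiliated
  measurable ε hε := by
    obtain ⟨K, hK, hKx, hKε⟩ := hx.tauDense ε hε
    refine ⟨proj K, hK.proj_mem, proj_isStarProjection K, ?_,
      exists_isMulBounded hx.closed hx.affiliated hK hKx⟩
    rw [← proj_orthogonal]; exact hKε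

/-- The closure of a symmetric subspace of `H × H` that is invariant under the commutant of `M` and
has `τ`-dense domain is the graph of an element of `L₀(M, τ)`. -/
theorem L0sa.of_graph_eq_closure {G : Submodule ℂ (H × H)}
    (hGa : ∀ y ∈ M.commutant, ∀ v ∈ G, (y v.1, y v.2) ∈ G) {D : Submodule ℂ H} (hD : TauDense τ D)
    (hDG : ∀ ξ ∈ D, ∃ η, (ξ, η) ∈ G)
    (hG : ∀ u ∈ G, ∀ v ∈ G, inner ℂ (u : H × H).2 (v : H × H).1 = inner ℂ u.1 v.2) :
    ∃ z, L0sa τ z ∧ z.graph = G.topologicalClosure ∧ z = G.topologicalClosure.toLinearPMap := by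
  have hsymm : ∀ u ∈ G.topologicalClosure, ∀ v ∈ G.topologicalClosure,
      inner ℂ (u : H × H).2 (v : H × H).1 = inner ℂ u.1 v.2 := by
    have h1 : ∀ u ∈ G, ∀ v ∈ G.topologicalClosure,
        inner ℂ (u : H × H).2 (v : H × H).1 = inner ℂ u.1 v.2 := fun u hu v hv =>
      closure_minimal (hG u hu) (isClosed_eq (by fun_prop) (by fun_prop)) hv
    exact fun u hu v hv => closure_minimal (s := (G : Set (H × H)))
      (t := {u | inner ℂ u.2 v.1 = inner ℂ u.1 v.2}) (fun u hu => h1 u hu v hv)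
      (isClosed_eq (by fun_prop) (by fun_prop)) hu
  have hfun : ∀ v ∈ G.topologicalClosure, v.1 = 0 → v.2 = 0 := by
    intro v hv h0
    refine hD.dense.eq_zero_of_inner_left (𝕜 := ℂ) fun ξ hξ => ?_
    obtain ⟨η, hη⟩ := hDG ξ hξ
    have := hsymm v hv _ (G.le_topologicalClosure hη)
    simpa [h0] using this
  have hgr := Submodule.toLinearPMap_graph_eq _ hfun
  refine ⟨_, ⟨?_, ?_, ?_, ?_⟩, hgr, rfl⟩
  · unfold LinearPMap.IsClosed
    rw [hgr]; exact Submodule.isClosed_topologicalClosure _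
  · intro y hy ξ
    have h1 := LinearPMap.mem_graph _ ξ
    rw [hgr] at h1 ⊢
    have h2 : Set.MapsTo (fun v : H × H => (y v.1, y v.2)) (G : Set (H × H)) G := hGa y hy
    exact h2.closure (by fun_prop) h1
  · refine hD.mono fun ξ hξ => ?_
    obtain ⟨η, hη⟩ := hDG ξ hξ
    refine LinearPMap.mem_domain_of_mem_graph (y := η) ?_
    rw [hgr]; exact G.le_topologicalClosure hη
  · unfold IsSymm
    rw [hgr]; exact hsymm

theorem L0sa.closure (ha : IsAffiliated M x) (hD : TauDense τ x.domain) (hs : IsSymm x) :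
    L0sa τ x.closure := by
  obtain ⟨z, hz, hzg, -⟩ := L0sa.of_graph_eq_closure (τ := τ) (G := x.graph)
    (fun y hy v hv => ha.map_mem hy hv) hD
    (fun ξ hξ => ⟨_, x.mem_graph ⟨ξ, hξ⟩⟩) hs
  have hcl : x.IsClosable := ⟨z, hzg.symm⟩
  have : z = x.closure := LinearPMap.eq_of_eq_graph (by
    rw [hzg, hcl.graph_closure_eq_closure_graph])
  rwa [← this]

theorem mem_graph_add {u v w : H} (hx : (u, v) ∈ x.graph) (hy : (u, w) ∈ y.graph) :
    (u, v + w) ∈ (x + y).graph := by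
  obtain ⟨a, h1, h2⟩ := x.mem_graph_iff.1 hx
  obtain ⟨b, h3, h4⟩ := y.mem_graph_iff.1 hy
  simp only at h1 h2 h3 h4
  rw [LinearPMap.mem_graph_iff]
  subst h1
  refine ⟨⟨a, a.2, ?_⟩, rfl, ?_⟩
  · rw [← h3]; exact b.2
  · rw [LinearPMap.add_apply, ← h2, ← h4]
    congr 2
    exact Subtype.ext h3.symm

theorem mem_graph_add_iff {v : H × H} : v ∈ (x + y).graph ↔
    ∃ a b, (v.1, a) ∈ x.graph ∧ (v.1, b) ∈ y.graph ∧ a + b = v.2 := by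
  constructor
  · intro h
    obtain ⟨ξ, h1, h2⟩ := LinearPMap.mem_graph_iff _ |>.1 h
    rw [LinearPMap.add_apply] at h2
    refine ⟨_, _, ?_, ?_, h2⟩
    · rw [← h1]; exact x.mem_graph ⟨ξ, ξ.2.1⟩
    · rw [← h1]; exact y.mem_graph ⟨ξ, ξ.2.2⟩
  · rintro ⟨a, b, h1, h2, h3⟩
    have := mem_graph_add h1 h2
    rwa [h3] at this

theorem mem_graph_neg_iff {v : H × H} : v ∈ (-x).graph ↔ (v.1, -v.2) ∈ x.graph := by
  rw [LinearPMap.mem_graph_iff, LinearPMap.mem_graph_iff]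
  constructor
  · rintro ⟨ξ, h1, h2⟩
    exact ⟨ξ, h1, by rw [← h2, LinearPMap.neg_apply]; simp⟩
  · rintro ⟨ξ, h1, h2⟩
    exact ⟨ξ, h1, by rw [LinearPMap.neg_apply]; simp [h2]⟩

theorem L0sa.neg (hx : L0sa τ x) : L0sa τ (-x) where
  closed := by
    have h1 : IsClosed (x.graph : Set (H × H)) := hx.closed
    have h2 : ((-x).graph : Set (H × H)) = (fun v : H × H => (v.1, -v.2)) ⁻¹' x.graph := by
      ext v; exact mem_graph_neg_iff
    unfold LinearPMap.IsClosed
    rw [h2]; exact h1.preimage (by fun_prop)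
  affiliated y hy ξ := by
    have h1 := LinearPMap.mem_graph _ ξ
    rw [mem_graph_neg_iff] at h1 ⊢
    simpa using hx.affiliated.map_mem hy h1
  tauDense := hx.tauDense
  symm u hu v hv := by
    rw [mem_graph_neg_iff] at hu hv
    simpa using hx.symm _ hu _ hv

theorem L0sa.add (hx : L0sa τ x) (hy : L0sa τ y) : L0sa τ (closedAdd x y) := by
  refine L0sa.closure ?_ (hx.tauDense.inf hy.tauDense) ?_
  · intro z hz ξ
    obtain ⟨a, b, h1, h2, h3⟩ := mem_graph_add_iff.1 (LinearPMap.mem_graph _ ξ)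
    rw [mem_graph_add_iff]
    refine ⟨_, _, hx.affiliated.map_mem hz h1, hy.affiliated.map_mem hz h2, ?_⟩
    rw [← map_add]; exact congrArg z h3
  · intro u hu v hv
    obtain ⟨a, b, h1, h2, h3⟩ := mem_graph_add_iff.1 hu
    obtain ⟨a', b', h1', h2', h3'⟩ := mem_graph_add_iff.1 hv
    rw [← h3, ← h3', inner_add_left, inner_add_right, hx.symm _ h1 _ h1', hy.symm _ h2 _ h2']

theorem closedSub_eq : closedSub x y = closedAdd x (-y) := by
  unfold closedSub closedAdd
  rw [sub_eq_add_neg]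

theorem L0sa.sub (hx : L0sa τ x) (hy : L0sa τ y) : L0sa τ (closedSub x y) := by
  rw [closedSub_eq]; exact hx.add hy.neg

theorem mem_graph_closedAdd {u v w : H} (hx : (u, v) ∈ x.graph) (hy : (u, w) ∈ y.graph) :
    (u, v + w) ∈ (closedAdd x y).graph :=
  LinearPMap.le_graph_of_le (LinearPMap.le_closure _) (mem_graph_add hx hy)

theorem mem_graph_closedSub {u v w : H} (hx : (u, v) ∈ x.graph) (hy : (u, w) ∈ y.graph) :
    (u, v - w) ∈ (closedSub x y).graph := by
  rw [closedSub_eq, sub_eq_add_neg]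
  refine mem_graph_closedAdd hx (mem_graph_neg_iff.2 ?_)
  simpa using hy

/-- Positivity may be checked on a `τ`-dense subspace. -/
theorem L0sa.isPos_of_tauDense (hx : L0sa τ x) {D : Submodule ℂ H} (hD : TauDense τ D)
    (h : ∀ ξ ∈ D, ∃ η, (ξ, η) ∈ x.graph ∧ 0 ≤ inner ℂ η ξ) : IsPos x := by
  rw [isPos_iff_graph]
  intro v hv
  have h1 := graph_le_closure_of_tauDense hx.closed hx.affiliated hD hv
  refine closure_minimal (t := {v : H × H | 0 ≤ inner ℂ v.2 v.1}) ?_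
    (isClosed_le continuous_const (by fun_prop)) h1
  rintro ⟨ξ, ζ⟩ ⟨h2, h3⟩
  obtain ⟨η, h4, h5⟩ := h ξ h3
  have : ζ = η := x.mem_graph_snd_inj h2 h4 rfl
  rw [this]; exact h5

theorem IsPos.closedAdd (hx : L0sa τ x) (hy : L0sa τ y) (hxp : IsPos x) (hyp : IsPos y) :
    IsPos (closedAdd x y) := by
  refine (hx.add hy).isPos_of_tauDense (hx.tauDense.inf hy.tauDense) fun ξ hξ => ?_
  refine ⟨_, mem_graph_closedAdd (x.mem_graph ⟨ξ, hξ.1⟩) (y.mem_graph ⟨ξ, hξ.2⟩), ?_⟩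
  rw [inner_add_left]
  exact add_nonneg (hxp ⟨ξ, hξ.1⟩) (hyp ⟨ξ, hξ.2⟩)

/-- Symmetric elements of `L₀(M, τ)` are selfadjoint: the domain of `x` is `τ`-dense, hence a core
for the adjoint of `x`. -/
theorem L0sa.mem_graph_of_inner (hx : L0sa τ x) {u w : H}
    (h : ∀ v ∈ x.graph, inner ℂ w (v : H × H).1 = inner ℂ u v.2) : (u, w) ∈ x.graph := by
  have hadj : ∀ {u w : H}, (u, w) ∈ x.adjoint.graph ↔
      ∀ v ∈ x.graph, inner ℂ w (v : H × H).1 = inner ℂ u v.2 := by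
    intro u w
    constructor
    · intro h v hv
      obtain ⟨a, h1, h2⟩ := LinearPMap.mem_graph_iff _ |>.1 h
      obtain ⟨b, h3, h4⟩ := LinearPMap.mem_graph_iff _ |>.1 hv
      simp only at h1 h2
      rw [← h1, ← h2, ← h3, ← h4]
      exact LinearPMap.adjoint_isFormalAdjoint hx.dense a b
    · intro h
      have h1 : ∀ v : x.domain, inner ℂ w (v : H) = inner ℂ u (x v) := fun v => h _ (x.mem_graph v)
      have h2 : u ∈ x.adjoint.domain := LinearPMap.mem_adjoint_domain_of_exists u ⟨w, h1⟩
      rw [LinearPMap.mem_graph_iff]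
      exact ⟨⟨u, h2⟩, rfl, LinearPMap.adjoint_apply_eq hx.dense ⟨u, h2⟩ h1⟩
  have hEq : x = x.adjoint := by
    refine eq_of_agree (τ := τ) hx.closed hx.affiliated (LinearPMap.adjoint_isClosed hx.dense) ?_
      hx.tauDense fun ξ hξ => ⟨_, x.mem_graph ⟨ξ, hξ⟩, ?_⟩
    · intro y hy ξ
      have h1 := LinearPMap.mem_graph _ ξ
      rw [hadj] at h1 ⊢
      intro v hv
      have h2 := h1 _ (hx.affiliated.map_mem (star_mem hy) hv)
      simpa only [inner_star_right] using h2
    · rw [hadj]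
      exact fun v hv => hx.symm _ (x.mem_graph ⟨ξ, hξ⟩) v hv
  rw [hEq, hadj]; exact h

end NCLp

namespace NCLp

variable {H : Type*} [NormedAddCommGroup H] [InnerProductSpace ℂ H] [CompleteSpace H]
  {M : VonNeumannAlgebra H} {τ : NSFTrace M} {x : H →ₗ.[ℂ] H}

open Filter Topology

/-! ### Truncations of positive measurable operators -/

/-- The function `min (λ, n)` of `λ`, expressed through `s = (1 + λ²)⁻¹`; here `δ = (1 + n²)⁻¹`.
It is extended to all real `s`, with the value `0` for `s ≥ 1`. -/
noncomputable def truncFun (δ s : ℝ) : ℝ := Real.sqrt (1 / max s δ - 1)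

/-- The value `s = (1 + λ²)⁻¹` that corresponds to `λ`. -/
noncomputable def level (l : ℝ) : ℝ := 1 / (1 + l ^ 2)

theorem level_pos (l : ℝ) : 0 < level l := by unfold level; positivity

theorem level_anti {l l' : ℝ} (h0 : 0 ≤ l) (h : l ≤ l') : level l' ≤ level l := by
  unfold level; gcongr

theorem tendsto_level {u : ℕ → ℝ} (hu : Tendsto u atTop atTop) :
    Tendsto (fun n => level (u n)) atTop (𝓝 0) := by
  have h1 : Tendsto (fun n => 1 + u n ^ 2) atTop atTop :=
    tendsto_atTop_add_const_left _ _ ((tendsto_pow_atTop two_ne_zero).comp hu)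
  refine h1.inv_tendsto_atTop.congr fun n => ?_
  simp [level]

theorem truncFun_nonneg (δ s : ℝ) : 0 ≤ truncFun δ s := Real.sqrt_nonneg _

theorem continuous_truncFun {δ : ℝ} (hδ : 0 < δ) : Continuous (truncFun δ) := by
  unfold truncFun
  exact ((continuous_const.div (by fun_prop) fun s =>
    (lt_of_lt_of_le hδ (le_max_right s δ)).ne').sub continuous_const).sqrt

theorem truncFun_le {δ l s : ℝ} (hδ : 0 < δ) (hl : 0 ≤ l) (hs : level l ≤ s) :
    truncFun δ s ≤ l := by
  unfold truncFun
  have h1 : level l ≤ max s δ := hs.trans (le_max_left _ _)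
  have h2 : 1 / max s δ ≤ 1 + l ^ 2 := by
    rw [div_le_iff₀ (lt_of_lt_of_le hδ (le_max_right s δ))]
    unfold level at h1
    rw [div_le_iff₀ (by positivity)] at h1
    linarith
  exact Real.sqrt_le_iff.2 ⟨hl, by linarith⟩

theorem le_truncFun {δ l s : ℝ} (hδ : 0 < δ) (hs : s ≤ level l) (hδl : δ ≤ level l) :
    l ≤ truncFun δ s := by
  unfold truncFun
  have h1 : max s δ ≤ level l := max_le hs hδl
  have h2 : 1 + l ^ 2 ≤ 1 / max s δ := by
    rw [le_div_iff₀ (lt_of_lt_of_le hδ (le_max_right s δ))]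
    unfold level at h1
    rw [le_div_iff₀ (by positivity)] at h1
    linarith
  exact Real.le_sqrt_of_sq_le (by linarith)

theorem continuous_truncFun_rpow {δ p : ℝ} (hδ : 0 < δ) (hp : 0 ≤ p) :
    Continuous fun s => truncFun δ s ^ p :=
  (continuous_truncFun hδ).rpow_const fun _ => Or.inr hp

theorem truncAbsPow_eq (p : ℝ) (n : ℕ) (x : H →ₗ.[ℂ] H) :
    truncAbsPow p n x = cfc (fun s => truncFun (level n) s ^ p) (invOneAddAbsSq x) := rfl

theorem invOneAddAbsSq_nonneg (x : H →ₗ.[ℂ] H) : 0 ≤ invOneAddAbsSq x := cornerFst_nonneg _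

theorem invOneAddAbsSq_isSelfAdjoint (x : H →ₗ.[ℂ] H) : IsSelfAdjoint (invOneAddAbsSq x) :=
  cornerFst_isSelfAdjoint _

theorem truncAbsPow_nonneg (p : ℝ) (n : ℕ) (x : H →ₗ.[ℂ] H) : 0 ≤ truncAbsPow p n x :=
  cfc_nonneg fun s _ => Real.rpow_nonneg (truncFun_nonneg _ s) p

theorem truncAbsPow_mem (hx : L0sa τ x) (p : ℝ) (n : ℕ) : truncAbsPow p n x ∈ M :=
  cfc_mem (inv_mem hx.closed hx.affiliated).1 _

/-- For positive `x`, the operator `x (1 + x²)⁻¹` is positive. -/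
theorem mulInv_nonneg (hx : L0sa τ x) (hp : IsPos x) : 0 ≤ mulInv x := by
  rw [nonneg_iff_inner]
  intro ξ
  -- `ξ = s ξ + x (w ξ)` by selfadjointness, where `s = (1 + x²)⁻¹` and `w = x s`
  have h1 : (mulInv x ξ, ξ - invOneAddAbsSq x ξ) ∈ x.graph :=
    hx.mem_graph_of_inner fun v hv => inner_sub_inv hx.closed ξ hv
  have h2 := (isPos_iff_graph.1 hp) _ h1
  have h3 := (isPos_iff_graph.1 hp) _ (inv_mem_graph hx.closed ξ)
  have h4 := hx.symm _ h1 _ h1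
  have e : inner ℂ (mulInv x ξ) ξ = inner ℂ (ξ - invOneAddAbsSq x ξ) (mulInv x ξ) +
      inner ℂ (mulInv x ξ) (invOneAddAbsSq x ξ) := by
    change inner ℂ (ξ - invOneAddAbsSq x ξ) (mulInv x ξ) =
      inner ℂ (mulInv x ξ) (ξ - invOneAddAbsSq x ξ) at h4
    rw [h4, ← inner_add_right]; simp
  rw [e]
  exact add_nonneg h2 h3

/-- The first column `(s, w)` of a projection satisfies `s = s² + w* w`. -/
theorem star_mulInv_mul (x : H →ₗ.[ℂ] H) :
    star (mulInv x) * mulInv x = invOneAddAbsSq x - invOneAddAbsSq x * invOneAddAbsSq x := by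
  have hs := invOneAddAbsSq_isSelfAdjoint x
  rw [← sub_eq_zero]
  refine ContinuousLinearMap.coe_injective ((inner_map_self_eq_zero _).1 fun ξ => ?_)
  simp only [ContinuousLinearMap.coe_coe]
  have h1 := norm_sq_corner (hilbertGraph x) ξ
  change ((‖invOneAddAbsSq x ξ‖ ^ 2 + ‖mulInv x ξ‖ ^ 2 : ℝ) : ℂ) =
    inner ℂ (invOneAddAbsSq x ξ) ξ at h1
  rw [sub_apply, sub_apply, inner_sub_left, inner_sub_left, inner_star_mul, ← h1]
  have h2 : inner ℂ ((invOneAddAbsSq x * invOneAddAbsSq x) ξ) ξ =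
      ((‖invOneAddAbsSq x ξ‖ ^ 2 : ℝ) : ℂ) := by
    have := inner_star_mul (invOneAddAbsSq x) ξ
    rwa [hs.star_eq] at this
  rw [h2]; push_cast; ring

/-- For positive `x`, the operator `x (1 + x²)⁻¹` is the positive square root of `s - s²`, where
`s = (1 + x²)⁻¹`. -/
theorem mulInv_eq_cfc (hx : L0sa τ x) (hp : IsPos x) :
    mulInv x = cfc (fun t => Real.sqrt (t - t * t)) (invOneAddAbsSq x) := by
  have hs := invOneAddAbsSq_isSelfAdjoint x
  have hw := mulInv_nonneg hx hp
  have hsq := star_mulInv_mul x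
  rw [hw.isSelfAdjoint.star_eq] at hsq
  have hpoly : cfc (fun t : ℝ => t - t * t) (invOneAddAbsSq x) =
      invOneAddAbsSq x - invOneAddAbsSq x * invOneAddAbsSq x := by
    rw [cfc_sub (fun t : ℝ => t) (fun t => t * t) _ (by fun_prop) (by fun_prop),
      cfc_mul (fun t : ℝ => t) (fun t => t) _ (by fun_prop) (by fun_prop), cfc_id' ℝ _ hs]
  have hnn : ∀ t ∈ spectrum ℝ (invOneAddAbsSq x), 0 ≤ t - t * t := by
    have h1 : 0 ≤ cfc (fun t : ℝ => t - t * t) (invOneAddAbsSq x) := by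
      rw [hpoly, ← hsq]
      have := star_mul_self_nonneg (mulInv x)
      rwa [hw.isSelfAdjoint.star_eq] at this
    exact (cfc_nonneg_iff (fun t : ℝ => t - t * t) _ (by fun_prop)).1 h1
  have h1 := CFC.sqrt_unique hsq hw
  have h2 : CFC.sqrt (invOneAddAbsSq x - invOneAddAbsSq x * invOneAddAbsSq x) =
      cfc (fun t => Real.sqrt (t - t * t)) (invOneAddAbsSq x) := by
    refine CFC.sqrt_unique ?_ (cfc_nonneg fun t _ => Real.sqrt_nonneg _)
    rw [← cfc_mul _ _ _ (by fun_prop) (by fun_prop), ← hpoly]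
    exact cfc_congr fun t ht => Real.mul_self_sqrt (hnn t ht)
  rw [← h1, h2]

/-- On the spectral subspace for `[0, l]`, a positive operator is given by its truncation. -/
theorem mem_graph_of_specSub (hx : L0sa τ x) (hp : IsPos x) {δ d : ℝ} (hd : 0 < d) (hdδ : d ≤ δ)
    {ξ : H} (hξ : ξ ∈ specSub (invOneAddAbsSq x) δ) :
    (ξ, cfc (truncFun d) (invOneAddAbsSq x) ξ) ∈ x.graph := by
  have hs := invOneAddAbsSq_isSelfAdjoint x
  set s := invOneAddAbsSq x with hsdef
  have hδ : 0 < δ := hd.trans_le hdδ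
  have hmax : ∀ t : ℝ, max t δ ≠ 0 := fun t => (lt_of_lt_of_le hδ (le_max_right t δ)).ne'
  have hg : Continuous fun t : ℝ => 1 / max t δ := continuous_const.div (by fun_prop) hmax
  have h1 : s (cfc (fun t : ℝ => 1 / max t δ) s ξ) = ξ := by
    have h2 : s (cfc (fun t : ℝ => 1 / max t δ) s ξ) =
        cfc (fun t : ℝ => t) s (cfc (fun t : ℝ => 1 / max t δ) s ξ) := by
      rw [cfc_id' ℝ s]
    rw [h2, cfc_mul_apply (f := fun t => t) continuous_id hg,
      cfc_apply_congr hξ (f := fun t => t * (1 / max t δ)) (continuous_id.mul hg) (g := fun _ => 1) continuous_const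
      (fun t ht => by
        have := hδ.trans_le ht
        simp [max_eq_left ht, this.ne']), cfc_const_one ℝ s]
    rfl
  have h3 := inv_mem_graph hx.closed (cfc (fun t : ℝ => 1 / max t δ) s ξ)
  rw [← hsdef, h1, mulInv_eq_cfc hx hp, ← hsdef, cfc_mul_apply (by fun_prop) hg] at h3
  rw [cfc_apply_congr hξ (continuous_truncFun hd) (g := fun t => √(t - t * t) * (1 / max t δ))
    (by fun_prop)]
  · exact h3
  · intro t ht
    have ht0 : 0 < t := hδ.trans_le ht
    rw [truncFun, max_eq_left ht, max_eq_left (hdδ.trans ht)]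
    have e : t - t * t = t ^ 2 * (1 / t - 1) := by field_simp
    rw [e, Real.sqrt_mul (sq_nonneg t), Real.sqrt_sq ht0.le]
    field_simp

/-- The spectral projections of `|x|` for `[0, m]` have small codimension for large `m`: otherwise
they would leave room for vectors on which `x` is both large and small. -/
theorem dim_specSub_orthogonal_le (hx : L0sa τ x) {ε : ℝ≥0∞} (hε : 0 < ε) :
    ∃ C : ℝ, 0 ≤ C ∧ ∀ l, C < l → dim τ (specSub (invOneAddAbsSq x) (level l))ᗮ ≤ ε := by
  obtain ⟨K, hK, hKx, hKε⟩ := hx.tauDense ε hε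
  obtain ⟨b, -, hb⟩ := exists_isMulBounded hx.closed hx.affiliated hK hKx
  refine ⟨‖b‖, norm_nonneg b, fun l hl => le_trans ?_ hKε⟩
  have hs := invOneAddAbsSq_isSelfAdjoint x
  refine dim_le_of_disjoint hK.orthogonal
    (specSub_isAff (inv_mem hx.closed hx.affiliated).1 _).orthogonal fun ξ hξ hξK => ?_
  have := hK.closed.completeSpace_coe
  rw [Submodule.orthogonal_orthogonal] at hξK
  have hgr := hb ξ
  rw [proj_eq_self hξK] at hgr
  have h1 := inner_sub_inv hx.closed ξ hgr
  have h2 := norm_sq_corner (hilbertGraph x) ξ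
  rw [← invOneAddAbsSq_eq] at h2
  have h3 := re_inner_le_orthogonal hs hξ
  rw [← h2, Complex.ofReal_re] at h3
  change ‖invOneAddAbsSq x ξ‖ ^ 2 + ‖mulInv x ξ‖ ^ 2 ≤ level l * ‖ξ‖ ^ 2 at h3
  simp only [inner_sub_left, inner_self_complex] at h1
  rw [sub_eq_iff_eq_add] at h1
  have h4 : ‖ξ‖ ^ 2 ≤ ‖mulInv x ξ‖ * (‖b‖ * ‖ξ‖) + ‖invOneAddAbsSq x ξ‖ * ‖ξ‖ := by
    have h5 : ‖ξ‖ ^ 2 = ‖(((‖ξ‖ ^ 2 : ℝ)) : ℂ)‖ := by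
      rw [Complex.norm_real, Real.norm_of_nonneg (by positivity)]
    rw [h5, h1]
    refine (norm_add_le _ _).trans (add_le_add ?_ (norm_inner_le_norm _ _))
    exact (norm_inner_le_norm _ _).trans (by gcongr; exact b.le_opNorm ξ)
  by_contra hne
  have hpos : 0 < ‖ξ‖ := norm_pos_iff.2 hne
  have h6 : ‖ξ‖ ≤ ‖mulInv x ξ‖ * ‖b‖ + ‖invOneAddAbsSq x ξ‖ := by
    refine le_of_mul_le_mul_right ?_ hpos
    nlinarith
  have h7 : ‖ξ‖ ^ 2 ≤ (1 + ‖b‖ ^ 2) * (level l * ‖ξ‖ ^ 2) := by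
    calc ‖ξ‖ ^ 2 ≤ (‖mulInv x ξ‖ * ‖b‖ + ‖invOneAddAbsSq x ξ‖) ^ 2 := by gcongr
      _ ≤ (1 + ‖b‖ ^ 2) * (‖invOneAddAbsSq x ξ‖ ^ 2 + ‖mulInv x ξ‖ ^ 2) := by
        nlinarith [sq_nonneg (‖mulInv x ξ‖ - ‖b‖ * ‖invOneAddAbsSq x ξ‖)]
      _ ≤ _ := by gcongr
  have h8 : (1 + ‖b‖ ^ 2) * level l < 1 := by
    unfold level
    rw [mul_one_div, div_lt_one (by positivity)]
    nlinarith [norm_nonneg b]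
  nlinarith [pow_pos hpos 2]

theorem exists_dim_specSub_orthogonal_le (hx : L0sa τ x) :
    ∀ ε : ℝ≥0∞, 0 < ε → ∃ m : ℕ, dim τ (specSub (invOneAddAbsSq x) (level m))ᗮ ≤ ε := by
  intro ε hε
  obtain ⟨C, -, hC⟩ := dim_specSub_orthogonal_le hx hε
  obtain ⟨m, hm⟩ := exists_nat_gt C
  exact ⟨m, hC m hm⟩

end NCLp

namespace NCLp

variable {H : Type*} [NormedAddCommGroup H] [InnerProductSpace ℂ H] [CompleteSpace H]
  {M : VonNeumannAlgebra H} {τ : NSFTrace M} {x y : H →ₗ.[ℂ] H}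
  (T : M.toStarSubalgebra ≃⋆ₐ[ℂ] M.toStarSubalgebra)

open Filter Topology

/-! ### The extension of an automorphism to measurable operators -/

theorem isClosed_algebra (M : VonNeumannAlgebra H) :
    IsClosed (M.toStarSubalgebra : Set (H →L[ℂ] H)) := by
  have : (M.toStarSubalgebra : Set (H →L[ℂ] H)) =
      ⋂ y ∈ M.commutant, {a : H →L[ℂ] H | y * a = a * y} := by
    ext a
    simp only [Set.mem_iInter, Set.mem_ofPred_eq]
    refine mem_iff_commutant.trans (forall₂_congr fun y _ => ?_)
    rw [ContinuousLinearMap.ext_iff]; rfl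
  rw [this]
  exact isClosed_biInter fun y _ => isClosed_eq (by fun_prop) (by fun_prop)

/-- An automorphism of `M` commutes with the functional calculus of operators on `H`. -/
theorem map_cfc_algebra (a : M.toStarSubalgebra) (ha : IsSelfAdjoint (a : H →L[ℂ] H)) {f : ℝ → ℝ}
    (hf : Continuous f) (h : cfc f (a : H →L[ℂ] H) ∈ M.toStarSubalgebra) :
    (T ⟨cfc f (a : H →L[ℂ] H), h⟩ : H →L[ℂ] H) = cfc f (T a : H →L[ℂ] H) := by
  have hcl := isClosed_algebra M
  have ha' : IsSelfAdjoint a := Subtype.ext ha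
  have hTa : IsSelfAdjoint (T a) := by
    rw [isSelfAdjoint_iff, ← map_star, ha'.star_eq]
  have hcoe : ∀ b : M.toStarSubalgebra, IsSelfAdjoint b →
      ((cfc f b : M.toStarSubalgebra) : H →L[ℂ] H) = cfc f (b : H →L[ℂ] H) := fun b hb =>
    StarAlgHomClass.map_cfc (S := ℂ) M.toStarSubalgebra.subtype f b hf.continuousOn
      continuous_subtype_val hb (by
        exact congrArg (fun c : M.toStarSubalgebra => (c : H →L[ℂ] H)) hb.star_eq)
  have h1 : (⟨cfc f (a : H →L[ℂ] H), h⟩ : M.toStarSubalgebra) = cfc f a :=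
    Subtype.ext (hcoe a ha').symm
  have h2 : T (cfc f a) = cfc f (T a) :=
    StarAlgHomClass.map_cfc (S := ℂ) T f a hf.continuousOn
      (StarAlgEquiv.isometry T).continuous ha' hTa
  rw [h1, h2, hcoe _ hTa]

theorem map_nonneg_algebra (a : M.toStarSubalgebra) (ha : 0 ≤ (a : H →L[ℂ] H)) :
    0 ≤ (T a : H →L[ℂ] H) := by
  have hm : CFC.sqrt (a : H →L[ℂ] H) ∈ M.toStarSubalgebra := by
    rw [CFC.sqrt_eq_real_sqrt (a : H →L[ℂ] H) ha, cfcₙ_eq_cfc]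
    exact cfc_mem a.2 _
  have h1 : a = star (⟨_, hm⟩ : M.toStarSubalgebra) * ⟨_, hm⟩ := by
    refine Subtype.ext ?_
    change (a : H →L[ℂ] H) = star (CFC.sqrt (a : H →L[ℂ] H)) * CFC.sqrt (a : H →L[ℂ] H)
    rw [(CFC.sqrt_nonneg (a : H →L[ℂ] H)).isSelfAdjoint.star_eq, CFC.sqrt_mul_sqrt_self _ ha]
  rw [h1, map_mul, map_star]
  exact star_mul_self_nonneg (T ⟨_, hm⟩ : H →L[ℂ] H)

theorem map_proj_isStarProjection {K : Submodule ℂ H} (hK : IsAff M K) :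
    IsStarProjection (T ⟨proj K, hK.proj_mem⟩ : H →L[ℂ] H) := by
  constructor
  · have h1 : (⟨proj K, hK.proj_mem⟩ : M.toStarSubalgebra) * ⟨proj K, hK.proj_mem⟩ =
        ⟨proj K, hK.proj_mem⟩ := Subtype.ext (proj_mul_self K)
    have h2 := congrArg (fun a => (T a : H →L[ℂ] H)) h1
    simp only [map_mul] at h2
    exact h2
  · have h1 : star (⟨proj K, hK.proj_mem⟩ : M.toStarSubalgebra) = ⟨proj K, hK.proj_mem⟩ :=
      Subtype.ext (proj_isSelfAdjoint K).star_eq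
    have h2 := congrArg (fun a => (T a : H →L[ℂ] H)) h1
    simp only [map_star] at h2
    exact h2

/-- The image under `T` of a closed subspace affiliated with `M`: the range of the image of its
projection. -/
noncomputable def mapSub (K : Submodule ℂ H) (hK : IsAff M K) : Submodule ℂ H :=
  (IsAff.of_isStarProjection (map_proj_isStarProjection T hK) (T ⟨proj K, hK.proj_mem⟩).2).choose

variable {K L : Submodule ℂ H} (hK : IsAff M K) (hL : IsAff M L)

theorem mapSub_isAff : IsAff M (mapSub T K hK) :=
  (IsAff.of_isStarProjection (map_proj_isStarProjection T hK)
    (T ⟨proj K, hK.proj_mem⟩).2).choose_spec.1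

theorem proj_mapSub : proj (mapSub T K hK) = T ⟨proj K, hK.proj_mem⟩ :=
  (IsAff.of_isStarProjection (map_proj_isStarProjection T hK)
    (T ⟨proj K, hK.proj_mem⟩).2).choose_spec.2

theorem mapSub_mono (h : K ≤ L) : mapSub T K hK ≤ mapSub T L hL := by
  have h1 : (⟨proj L, hL.proj_mem⟩ : M.toStarSubalgebra) * ⟨proj K, hK.proj_mem⟩ =
      ⟨proj K, hK.proj_mem⟩ := by
    refine Subtype.ext (ContinuousLinearMap.ext fun ξ => ?_)
    exact proj_eq_self (h (proj_mem hK.closed ξ))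
  have h2 := congrArg (fun a => (T a : H →L[ℂ] H)) h1
  simp only [map_mul] at h2
  change (T _ : H →L[ℂ] H) * (T _ : H →L[ℂ] H) = _ at h2
  rw [← proj_mapSub T hK, ← proj_mapSub T hL] at h2
  intro ξ hξ
  have h3 := congrArg (fun a : H →L[ℂ] H => a ξ) h2
  change proj _ (proj _ ξ) = proj _ ξ at h3
  rw [proj_eq_self hξ] at h3
  rw [← h3]
  exact proj_mem (mapSub_isAff T hL).closed _

theorem dim_mapSub_orthogonal (hTτ : IsTracePreserving τ T) :
    dim τ (mapSub T K hK)ᗮ = dim τ Kᗮ := by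
  have h := hTτ ⟨proj Kᗮ, hK.orthogonal.proj_mem⟩ (proj_nonneg _)
  unfold dim
  rw [proj_orthogonal, proj_mapSub]
  change τ.toFun (T ⟨proj Kᗮ, hK.orthogonal.proj_mem⟩) = τ.toFun (proj Kᗮ) at h
  rw [← h]
  congr 1
  have h1 : (⟨proj Kᗮ, hK.orthogonal.proj_mem⟩ : M.toStarSubalgebra) =
      1 - ⟨proj K, hK.proj_mem⟩ := Subtype.ext (proj_orthogonal K)
  rw [h1, map_sub, map_one]
  rfl

theorem mul_apply_algebra (a b : M.toStarSubalgebra) (ξ : H) :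
    (T (a * b) : H →L[ℂ] H) ξ = (T a : H →L[ℂ] H) ((T b : H →L[ℂ] H) ξ) := by
  rw [map_mul]; rfl

theorem inner_map_algebra (a b : M.toStarSubalgebra) (ξ η : H) :
    inner ℂ ((T a : H →L[ℂ] H) ξ) ((T b : H →L[ℂ] H) η) =
      inner ℂ ((T (star b * a) : H →L[ℂ] H) ξ) η := by
  rw [mul_apply_algebra, map_star]
  exact (inner_star_left _ _ _).symm

theorem star_mul_eq_of_inner {a b c d : H →L[ℂ] H}
    (h : ∀ ξ η, inner ℂ (c ξ) (a η) = inner ℂ (d ξ) (b η)) : star a * c = star b * d :=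
  ContinuousLinearMap.ext fun ζ => ext_inner_right ℂ fun ζ' =>
    (inner_star_left a (c ζ) ζ').trans ((h ζ ζ').trans (inner_star_left b (d ζ) ζ').symm)

theorem inner_map_congr {a b c d : M.toStarSubalgebra}
    (h : ∀ ξ η, inner ℂ ((c : H →L[ℂ] H) ξ) ((a : H →L[ℂ] H) η) =
      inner ℂ ((d : H →L[ℂ] H) ξ) ((b : H →L[ℂ] H) η)) (ξ η : H) :
    inner ℂ ((T c : H →L[ℂ] H) ξ) ((T a : H →L[ℂ] H) η) =
      inner ℂ ((T d : H →L[ℂ] H) ξ) ((T b : H →L[ℂ] H) η) := by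
  have e : star a * c = star b * d := Subtype.ext (star_mul_eq_of_inner h)
  rw [inner_map_algebra, inner_map_algebra, e]

/-- The vectors `(T(a) ξ, T(x a) ξ)` that generate the graph of `T(x)`. -/
def extGen (x : H →ₗ.[ℂ] H) : Set (H × H) :=
  {v : H × H | ∃ a b : M.toStarSubalgebra, IsMulBounded x a b ∧
    ∃ ξ : H, v = ((T a : H →L[ℂ] H) ξ, (T b : H →L[ℂ] H) ξ)}

/-- The generating vectors of `T(x)` span a symmetric relation with `τ`-dense domain, whose closure
is therefore the graph of an operator. -/
theorem extend_spec (hTτ : IsTracePreserving τ T) (hx : L0sa τ x) :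
    L0sa τ (extend T x) ∧ (extend T x).graph = extGraph T x := by
  suffices h : ∃ z, L0sa τ z ∧ z.graph = extGraph T x ∧ z = (extGraph T x).toLinearPMap by
    obtain ⟨z, hz, h1, rfl⟩ := h
    exact ⟨hz, h1⟩
  refine L0sa.of_graph_eq_closure (G := Submodule.span ℂ (extGen T x))
    (D := (Submodule.span ℂ (extGen T x)).map (LinearMap.fst ℂ H H)) ?_ ?_ ?_ ?_
  · intro y hy v hv
    have h : Submodule.span ℂ (extGen T x) ≤
        (Submodule.span ℂ (extGen T x)).comap (y.toLinearMap.prodMap y.toLinearMap) := by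
      refine Submodule.span_le.2 ?_
      rintro _ ⟨a, b, hab, ξ, rfl⟩
      refine Submodule.subset_span ⟨a, b, hab, y ξ, ?_⟩
      rw [← mem_iff_commutant.1 (T a).2 y hy, ← mem_iff_commutant.1 (T b).2 y hy]
      rfl
    exact h hv
  · intro ε hε
    obtain ⟨K, hK, hKx, hKε⟩ := hx.tauDense ε hε
    obtain ⟨b, hbM, hb⟩ := exists_isMulBounded hx.closed hx.affiliated hK hKx
    refine ⟨mapSub T K hK, mapSub_isAff T hK, fun ξ hξ => ?_, ?_⟩
    · refine ⟨_, Submodule.subset_span ⟨⟨proj K, hK.proj_mem⟩, ⟨b, hbM⟩, hb, ξ, rfl⟩, ?_⟩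
      change (T ⟨proj K, hK.proj_mem⟩ : H →L[ℂ] H) ξ = ξ
      rw [← proj_mapSub T hK, proj_eq_self hξ]
    · rwa [dim_mapSub_orthogonal T hK hTτ]
  · rintro ξ ⟨v, hv, rfl⟩
    exact ⟨v.2, hv⟩
  · have hgen : ∀ u ∈ extGen T x, ∀ v ∈ extGen T x,
        inner ℂ (u : H × H).2 (v : H × H).1 = inner ℂ u.1 v.2 := by
      rintro _ ⟨a, b, hab, ξ, rfl⟩ _ ⟨a', b', hab', ξ', rfl⟩
      exact inner_map_congr T (fun ζ ζ' => hx.symm _ (hab ζ) _ (hab' ζ')) ξ ξ'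
    have h1 : ∀ u ∈ extGen T x, ∀ v ∈ Submodule.span ℂ (extGen T x),
        inner ℂ (u : H × H).2 (v : H × H).1 = inner ℂ u.1 v.2 := by
      intro u hu v hv
      induction hv using Submodule.span_induction with
      | mem v hv => exact hgen u hu v hv
      | zero => simp
      | add v w _ _ h h' => simp [h, h']
      | smul c v _ h => simp [h]
    intro u hu v hv
    induction hu using Submodule.span_induction with
    | mem u hu => exact h1 u hu v hv
    | zero => simp
    | add u w _ _ h h' => simp [h, h']
    | smul c u _ h => simp [h]

variable {T}

theorem L0sa.extend (hTτ : IsTracePreserving τ T) (hx : L0sa τ x) : L0sa τ (extend T x) := (extend_spec T hTτ hx).1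

theorem mem_graph_extend (hTτ : IsTracePreserving τ T) (hx : L0sa τ x) {a b : H →L[ℂ] H} (ha : a ∈ M) (hb : b ∈ M)
    (hab : IsMulBounded x a b) (ξ : H) :
    ((T ⟨a, ha⟩ : H →L[ℂ] H) ξ, (T ⟨b, hb⟩ : H →L[ℂ] H) ξ) ∈ (NCLp.extend T x).graph := by
  rw [(extend_spec T hTτ hx).2]
  exact Submodule.le_topologicalClosure _ (Submodule.subset_span ⟨⟨a, ha⟩, ⟨b, hb⟩, hab, ξ, rfl⟩)

/-- The extension of `T` is additive. -/
theorem extend_closedAdd (hTτ : IsTracePreserving τ T) (hx : L0sa τ x) (hy : L0sa τ y) :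
    extend T (closedAdd x y) = closedAdd (extend T x) (extend T y) := by
  have hz := hx.add hy
  have h1 := hz.extend hTτ
  have h2 := (hx.extend hTτ).add (hy.extend hTτ)
  refine eq_of_agree (τ := τ) h1.closed h1.affiliated h2.closed h2.affiliated
    (D := ((extend T (closedAdd x y)).graph ⊓ (closedAdd (extend T x) (extend T y)).graph).map
      (LinearMap.fst ℂ H H)) ?_ ?_
  · intro ε hε
    obtain ⟨K, hK, hKD, hKε⟩ := (hx.tauDense.inf hy.tauDense) ε hε
    obtain ⟨a, haM, ha⟩ := exists_isMulBounded hx.closed hx.affiliated hK (hKD.trans inf_le_left)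
    obtain ⟨b, hbM, hb⟩ := exists_isMulBounded hy.closed hy.affiliated hK (hKD.trans inf_le_right)
    refine ⟨mapSub T K hK, mapSub_isAff T hK, fun ξ hξ => ?_, ?_⟩
    · have e1 := mem_graph_extend hTτ hx hK.proj_mem haM ha ξ
      have e2 := mem_graph_extend hTτ hy hK.proj_mem hbM hb ξ
      have e3 := mem_graph_extend hTτ hz hK.proj_mem (add_mem haM hbM)
        (fun ζ => mem_graph_closedAdd (ha ζ) (hb ζ)) ξ
      have e4 := mem_graph_closedAdd e1 e2
      have e5 : (T ⟨a + b, add_mem haM hbM⟩ : H →L[ℂ] H) ξ =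
          (T ⟨a, haM⟩ : H →L[ℂ] H) ξ + (T ⟨b, hbM⟩ : H →L[ℂ] H) ξ := by
        have : (⟨a + b, add_mem haM hbM⟩ : M.toStarSubalgebra) = ⟨a, haM⟩ + ⟨b, hbM⟩ := rfl
        rw [this, map_add]; rfl
      rw [e5] at e3
      refine ⟨_, ⟨e3, e4⟩, ?_⟩
      change (T ⟨proj K, hK.proj_mem⟩ : H →L[ℂ] H) ξ = ξ
      rw [← proj_mapSub T hK, proj_eq_self hξ]
    · rwa [dim_mapSub_orthogonal T hK hTτ]
  · rintro ξ ⟨v, hv, rfl⟩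
    exact ⟨v.2, hv⟩

/-- The extension of `T` is positive. The union of the images under `T` of the spectral subspaces
of `x` is a `τ`-dense subspace on which the form of `T(x)` is visibly positive. -/
theorem isPos_extend (hTτ : IsTracePreserving τ T) (hx : L0sa τ x) (hp : IsPos x) : IsPos (extend T x) := by
  have hsM := (inv_mem hx.closed hx.affiliated).1
  let K : ℕ → Submodule ℂ H := fun m => specSub (invOneAddAbsSq x) (level m)
  have hK : ∀ m, IsAff M (K m) := fun m => specSub_isAff hsM _
  have hmono : Monotone K := fun m n hmn =>
    specSub_anti _ (level_anti (Nat.cast_nonneg m) (by exact_mod_cast hmn))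
  have hKx : ∀ m, K m ≤ x.domain := fun m ξ hξ =>
    LinearPMap.mem_domain_of_mem_graph (mem_graph_of_specSub hx hp (level_pos m) le_rfl hξ)
  have hmono' : Monotone fun m => mapSub T (K m) (hK m) := fun m n hmn =>
    mapSub_mono T (hK m) (hK n) (hmono hmn)
  refine (hx.extend hTτ).isPos_of_tauDense (D := ⨆ m, mapSub T (K m) (hK m)) ?_ ?_
  · intro ε hε
    obtain ⟨m, hm⟩ := exists_dim_specSub_orthogonal_le hx ε hε
    refine ⟨mapSub T (K m) (hK m), mapSub_isAff T (hK m),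
      le_iSup (fun m => mapSub T (K m) (hK m)) m, ?_⟩
    rwa [dim_mapSub_orthogonal T (hK m) hTτ]
  · intro ξ hξ
    rw [Submodule.mem_iSup_of_directed _ hmono'.directed_le] at hξ
    obtain ⟨m, hm⟩ := hξ
    obtain ⟨b, hbM, hb⟩ := exists_isMulBounded hx.closed hx.affiliated (hK m) (hKx m)
    have h1 := mem_graph_extend hTτ hx (hK m).proj_mem hbM hb ξ
    have h2 : (T ⟨proj (K m), (hK m).proj_mem⟩ : H →L[ℂ] H) ξ = ξ := by
      rw [← proj_mapSub T (hK m), proj_eq_self hm]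
    have h3 : 0 ≤ inner ℂ ((T ⟨b, hbM⟩ : H →L[ℂ] H) ξ)
        ((T ⟨proj (K m), (hK m).proj_mem⟩ : H →L[ℂ] H) ξ) := by
      rw [inner_map_algebra]
      refine nonneg_iff_inner.1 (map_nonneg_algebra T _ (nonneg_iff_inner.2 fun ζ => ?_)) ξ
      change 0 ≤ inner ℂ ((star (proj (K m)) * b) ζ) ζ
      have : inner ℂ ((star (proj (K m)) * b) ζ) ζ = inner ℂ (b ζ) (proj (K m) ζ) :=
        inner_star_left _ _ _
      rw [this]
      exact isPos_iff_graph.1 hp _ (hb ζ)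
    rw [h2] at h1 h3
    exact ⟨_, h1, h3⟩

/-- `(1 + |T(x)|²)⁻¹ = T((1 + |x|²)⁻¹)`: the right-hand side has the defining property of the corner
of the projection onto the graph of `T(x)`. -/
theorem inv_extend (hTτ : IsTracePreserving τ T) (hx : L0sa τ x) :
    invOneAddAbsSq (extend T x) =
      T ⟨invOneAddAbsSq x, (inv_mem hx.closed hx.affiliated).1⟩ := by
  obtain ⟨hsM, hwM⟩ := inv_mem hx.closed hx.affiliated
  ext ξ
  refine (inv_unique (hx.extend hTτ).closed (w := (T ⟨mulInv x, hwM⟩ : H →L[ℂ] H) ξ) ?_ ?_).1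
  · exact mem_graph_extend hTτ hx hsM hwM (inv_mem_graph hx.closed) ξ
  · rw [(extend_spec T hTτ hx).2]
    intro v hv
    refine closure_minimal (s := ((Submodule.span ℂ (extGen T x) : Submodule ℂ (H × H)) :
      Set (H × H))) (t := {v : H × H | inner ℂ (ξ - (T ⟨invOneAddAbsSq x, hsM⟩ : H →L[ℂ] H) ξ) v.1 =
        inner ℂ ((T ⟨mulInv x, hwM⟩ : H →L[ℂ] H) ξ) v.2}) ?_
      (isClosed_eq (by fun_prop) (by fun_prop)) hv
    intro v hv
    change inner ℂ _ v.1 = inner ℂ _ v.2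
    induction hv using Submodule.span_induction with
    | mem v hv =>
      obtain ⟨a, b, hab, ζ, rfl⟩ := hv
      have e1 : ξ - (T ⟨invOneAddAbsSq x, hsM⟩ : H →L[ℂ] H) ξ =
          (T (1 - ⟨invOneAddAbsSq x, hsM⟩) : H →L[ℂ] H) ξ := by
        rw [map_sub, map_one]; rfl
      rw [e1]
      exact inner_map_congr T (fun η η' => inner_sub_inv hx.closed η (hab η')) ξ ζ
    | zero => simp
    | add v w _ _ h h' => simp only [Prod.fst_add, Prod.snd_add, inner_add_right, h, h']
    | smul c v _ h => simp only [Prod.smul_fst, Prod.smul_snd, inner_smul_right, h]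

theorem lpNorm_extend (hTτ : IsTracePreserving τ T) (hx : L0sa τ x) {p : ℝ} (hp : 0 ≤ p) :
    lpNorm τ p (extend T x) = lpNorm τ p x := by
  unfold lpNorm
  congr 1
  refine iSup_congr fun n => ?_
  have hsM := (inv_mem hx.closed hx.affiliated).1
  rw [truncAbsPow_eq, truncAbsPow_eq, inv_extend hTτ hx,
    ← map_cfc_algebra T ⟨invOneAddAbsSq x, hsM⟩ (invOneAddAbsSq_isSelfAdjoint x)
      (continuous_truncFun_rpow (level_pos n) hp) (cfc_mem hsM _)]
  refine hTτ _ ?_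
  exact truncAbsPow_nonneg p n x

end NCLp

namespace NCLp

variable {H : Type*} [NormedAddCommGroup H] [InnerProductSpace ℂ H] [CompleteSpace H]
  {M : VonNeumannAlgebra H} {τ : NSFTrace M} {x y : H →ₗ.[ℂ] H}

open Filter Topology

/-! ### The triangle inequality in `L_p(M, τ)` -/

theorem trace_smul {c : ℝ} (hc : 0 ≤ c) {a : H →L[ℂ] H} (ha : a ∈ M) (h0 : 0 ≤ a) :
    τ.toFun ((c : ℂ) • a) = ENNReal.ofReal c * τ.toFun a := by
  have := τ.map_smul ⟨c, hc⟩ a ha h0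
  rw [ENNReal.ofReal, Real.toNNReal_of_nonneg hc]
  exact this

theorem trace_sum {ι : Type*} (I : Finset ι) {a : ι → H →L[ℂ] H} (ha : ∀ i ∈ I, a i ∈ M)
    (h0 : ∀ i ∈ I, 0 ≤ a i) : τ.toFun (∑ i ∈ I, a i) = ∑ i ∈ I, τ.toFun (a i) := by
  classical
  induction I using Finset.induction_on with
  | empty => simpa using trace_zero τ
  | insert i I hi ih =>
    rw [Finset.sum_insert hi, Finset.sum_insert hi, τ.map_add _ _ (ha i (Finset.mem_insert_self i I))
      (sum_mem fun j hj => ha j (Finset.mem_insert_of_mem hj)) (h0 i (Finset.mem_insert_self i I))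
      (Finset.sum_nonneg fun j hj => h0 j (Finset.mem_insert_of_mem hj)),
      ih (fun j hj => ha j (Finset.mem_insert_of_mem hj))
        (fun j hj => h0 j (Finset.mem_insert_of_mem hj))]

theorem conj_nonneg {a q : H →L[ℂ] H} (ha : 0 ≤ a) (hq : IsSelfAdjoint q) : 0 ≤ q * a * q := by
  have := star_left_conjugate_nonneg ha q
  rwa [hq.star_eq] at this

theorem inner_conj {a q : H →L[ℂ] H} (hq : IsSelfAdjoint q) (ξ : H) :
    inner ℂ ((q * a * q) ξ) ξ = inner ℂ (a (q ξ)) (q ξ) :=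
  inner_isSelfAdjoint hq _ _

/-- `τ(q r² q) = τ(r q r)` for a projection `q` and a selfadjoint `r`. -/
theorem trace_conj_comm {r : H →L[ℂ] H} (hr : r ∈ M) (hrs : IsSelfAdjoint r) {K : Submodule ℂ H}
    (hK : IsAff M K) : τ.toFun (proj K * (r * r) * proj K) = τ.toFun (r * proj K * r) := by
  have h := τ.tracial (r * proj K) (mul_mem hr hK.proj_mem)
  rw [star_mul, hrs.star_eq, (proj_isSelfAdjoint K).star_eq] at h
  have e1 : proj K * r * (r * proj K) = proj K * (r * r) * proj K := by noncomm_ring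
  have e2 : r * proj K * (proj K * r) = r * proj K * r := by
    rw [mul_assoc, ← mul_assoc (proj K), proj_mul_self, ← mul_assoc]
  rw [e1, e2] at h
  exact h

/-- Compressing to orthogonal blocks does not increase the trace. -/
theorem sum_trace_conj_le {a : H →L[ℂ] H} (ha : a ∈ M) (h0 : 0 ≤ a) {ι : Type*} (I : Finset ι)
    {K : ι → Submodule ℂ H} (hK : ∀ i, IsAff M (K i)) (hsum : ∑ i ∈ I, proj (K i) ≤ 1) :
    ∑ i ∈ I, τ.toFun (proj (K i) * a * proj (K i)) ≤ τ.toFun a := by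
  set r := CFC.sqrt a with hr
  have hrM : r ∈ M := by
    rw [hr, CFC.sqrt_eq_real_sqrt a h0, cfcₙ_eq_cfc]
    exact cfc_mem ha _
  have hrs : IsSelfAdjoint r := (CFC.sqrt_nonneg a).isSelfAdjoint
  have hrr : r * r = a := CFC.sqrt_mul_sqrt_self a h0
  rw [← hrr]
  simp only [fun i => trace_conj_comm (τ := τ) hrM hrs (hK i)]
  rw [← trace_sum I (fun i _ => mul_mem (mul_mem hrM (hK i).proj_mem) hrM)
    (fun i _ => conj_nonneg (proj_nonneg _) hrs)]
  refine trace_mono τ (sum_mem fun i _ => mul_mem (mul_mem hrM (hK i).proj_mem) hrM)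
    (mul_mem hrM hrM) (Finset.sum_nonneg fun i _ => conj_nonneg (proj_nonneg _) hrs) ?_
  rw [← Finset.sum_mul, ← Finset.mul_sum, ← sub_nonneg]
  have e : r * r - r * (∑ i ∈ I, proj (K i)) * r = r * (1 - ∑ i ∈ I, proj (K i)) * r := by
    noncomm_ring
  rw [e]
  exact conj_nonneg (sub_nonneg.2 hsum) hrs

theorem re_inner_cfc_affine {s : H →L[ℂ] H} (hs : IsSelfAdjoint s) {f : ℝ → ℝ} (hf : Continuous f)
    (κ C : ℝ) (ξ : H) : (inner ℂ (cfc (fun t => κ * f t + C) s ξ) ξ).re =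
      κ * (inner ℂ (cfc f s ξ) ξ).re + C * ‖ξ‖ ^ 2 := by
  rw [cfc_add s (fun t => κ * f t) (fun _ => C) (by fun_prop) (by fun_prop), add_apply,
    inner_add_left, Complex.add_re, inner_cfc_const hs, cfc_const_mul κ f s (by fun_prop)]
  congr 1
  have : (κ • cfc f s) ξ = (κ : ℂ) • cfc f s ξ := by simp
  rw [this, inner_smul_left, Complex.conj_ofReal, Complex.re_ofReal_mul]

/-- The tangent line inequality for `u ↦ u ^ p` at `l`. -/
theorem young_tangent {p u l : ℝ} (hp : 1 ≤ p) (hu : 0 ≤ u) (hl : 0 < l) :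
    p * u ≤ l ^ (1 - p) * u ^ p + (p - 1) * l := by
  have h := one_add_mul_self_le_rpow_one_add (s := u / l - 1) (by
    have := div_nonneg hu hl.le; linarith) hp
  have e : (1 + (u / l - 1)) = u / l := by ring
  rw [e, Real.div_rpow hu hl.le] at h
  have h2 := mul_le_mul_of_nonneg_left h hl.le
  have e2 : l * (u ^ p / l ^ p) = l ^ (1 - p) * u ^ p := by
    rw [Real.rpow_sub hl, Real.rpow_one]; ring
  have e3 : l * (1 + p * (u / l - 1)) = p * u - (p - 1) * l := by field_simp; ring
  rw [e2, e3] at h2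
  linarith

theorem re_inner_truncFun_le (x : H →ₗ.[ℂ] H) {p l : ℝ} (hp : 1 ≤ p) (hl : 0 < l) (m : ℕ) (ξ : H) :
    p * (inner ℂ (cfc (truncFun (level m)) (invOneAddAbsSq x) ξ) ξ).re ≤
      l ^ (1 - p) * (inner ℂ (truncAbsPow p m x ξ) ξ).re + (p - 1) * l * ‖ξ‖ ^ 2 := by
  have hs := invOneAddAbsSq_isSelfAdjoint x
  have hc := continuous_truncFun (level_pos m)
  have hcp := continuous_truncFun_rpow (level_pos m) (zero_le_one.trans hp)
  have h := re_inner_cfc_mono (s := invOneAddAbsSq x) (f := fun t => p * truncFun (level m) t + 0)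
    (g := fun t => l ^ (1 - p) * truncFun (level m) t ^ p + (p - 1) * l) (by fun_prop) (by fun_prop)
    (fun t => by simpa using young_tangent hp (truncFun_nonneg (level m) t) hl) ξ
  rw [re_inner_cfc_affine hs hc, re_inner_cfc_affine hs hcp, zero_mul, add_zero] at h
  exact h

theorem tendsto_dim_specSub (hx : L0sa τ x) :
    Tendsto (fun m : ℕ => dim τ (specSub (invOneAddAbsSq x) (level m))ᗮ) atTop (𝓝 0) := by
  rw [ENNReal.tendsto_nhds_zero]
  intro ε hε
  obtain ⟨C, -, hC⟩ := dim_specSub_orthogonal_le hx hε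
  obtain ⟨m, hm⟩ := exists_nat_gt C
  exact eventually_atTop.2 ⟨m, fun n hn => hC n (hm.trans_le (by exact_mod_cast hn))⟩

/-- The spectral subspace of `x` for the interval `(l, l']`. -/
noncomputable def bandSub (x : H →ₗ.[ℂ] H) (l l' : ℝ) : Submodule ℂ H :=
  specSub (invOneAddAbsSq x) (level l') ⊓ (specSub (invOneAddAbsSq x) (level l))ᗮ

theorem bandSub_isAff (hx : L0sa τ x) (l l' : ℝ) : IsAff M (bandSub x l l') :=
  (specSub_isAff (inv_mem hx.closed hx.affiliated).1 _).inf
    (specSub_isAff (inv_mem hx.closed hx.affiliated).1 _).orthogonal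

theorem proj_bandSub (x : H →ₗ.[ℂ] H) {l l' : ℝ} (h0 : 0 ≤ l) (h : l ≤ l') :
    proj (bandSub x l l') =
      proj (specSub (invOneAddAbsSq x) (level l')) - proj (specSub (invOneAddAbsSq x) (level l)) := by
  rw [proj_add_proj (isClosed_specSub _ _) (isClosed_specSub _ _)
    (specSub_anti (invOneAddAbsSq x) (level_anti h0 h))]
  simp [bandSub]

/-- Convexity of `t ↦ t ^ p`, for the forms of `x`, `y` and `x + y` on vectors at which
`x + y ≥ l`. -/
theorem rpow_le_of_mem_bandSub (hx : L0sa τ x) (hy : L0sa τ y) (hxp : IsPos x) (hyp : IsPos y)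
    {p α β l l' : ℝ} (hp : 1 ≤ p) (hα : 0 < α) (hβ : 0 < β) (hαβ : α + β = 1) (hl : 0 < l)
    (hll : l ≤ l') (m : ℕ) {ξ : H} (hξ : ξ ∈ bandSub (closedAdd x y) l l')
    (hξx : ξ ∈ specSub (invOneAddAbsSq x) (level m))
    (hξy : ξ ∈ specSub (invOneAddAbsSq y) (level m)) :
    l ^ p * ‖ξ‖ ^ 2 ≤ α ^ (1 - p) * (inner ℂ (truncAbsPow p m x ξ) ξ).re +
      β ^ (1 - p) * (inner ℂ (truncAbsPow p m y ξ) ξ).re := by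
  have hz := hx.add hy
  have hzp := IsPos.closedAdd hx hy hxp hyp
  have g1 := mem_graph_of_specSub hz hzp (level_pos l') le_rfl hξ.1
  have g2 := mem_graph_of_specSub hx hxp (level_pos m) le_rfl hξx
  have g3 := mem_graph_of_specSub hy hyp (level_pos m) le_rfl hξy
  have e := LinearPMap.mem_graph_snd_inj _ g1 (mem_graph_closedAdd g2 g3) rfl
  have h1 := le_re_inner_cfc_orthogonal (invOneAddAbsSq_isSelfAdjoint (closedAdd x y)) hξ.2
    (continuous_truncFun (level_pos l')) (C := l)
    (fun t ht => le_truncFun (level_pos l') ht (level_anti hl.le hll))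
  rw [e, inner_add_left, Complex.add_re] at h1
  have h2 := re_inner_truncFun_le x hp (mul_pos hα hl) m ξ
  have h3 := re_inner_truncFun_le y hp (mul_pos hβ hl) m ξ
  rw [Real.mul_rpow hα.le hl.le] at h2
  rw [Real.mul_rpow hβ.le hl.le] at h3
  set u := (inner ℂ (truncAbsPow p m x ξ) ξ).re
  set v := (inner ℂ (truncAbsPow p m y ξ) ξ).re
  have h4 : l * ‖ξ‖ ^ 2 ≤ l ^ (1 - p) * (α ^ (1 - p) * u + β ^ (1 - p) * v) := by
    have h5 := mul_le_mul_of_nonneg_left h1 (zero_le_one.trans hp)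
    have e3 : (p - 1) * (α * l) * ‖ξ‖ ^ 2 + (p - 1) * (β * l) * ‖ξ‖ ^ 2 =
        (p - 1) * l * ‖ξ‖ ^ 2 := by
      rw [← add_mul, ← mul_add, ← add_mul, hαβ, one_mul]
    nlinarith
  have h6 := mul_le_mul_of_nonneg_left h4 (Real.rpow_nonneg hl.le (p - 1))
  have e4 : l ^ (p - 1) * (l * ‖ξ‖ ^ 2) = l ^ p * ‖ξ‖ ^ 2 := by
    rw [← mul_assoc, Real.rpow_sub_one hl.ne']; field_simp
  have e5 : l ^ (p - 1) * l ^ (1 - p) = 1 := by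
    rw [← Real.rpow_add hl]; simp
  rwa [e4, ← mul_assoc, e5, one_mul] at h6

theorem le_of_re_inner {a b : H →L[ℂ] H} (ha : IsSelfAdjoint a) (hb : IsSelfAdjoint b)
    (h : ∀ ξ, (inner ℂ (a ξ) ξ).re ≤ (inner ℂ (b ξ) ξ).re) : a ≤ b := by
  have hreal : ∀ {c : H →L[ℂ] H}, IsSelfAdjoint c → ∀ ξ, (inner ℂ (c ξ) ξ).im = 0 := by
    intro c hc ξ
    refine Complex.conj_eq_iff_im.1 ?_
    rw [inner_conj_symm, inner_isSelfAdjoint hc]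
  refine le_iff_inner.2 fun ξ => Complex.le_def.2 ⟨h ξ, ?_⟩
  rw [hreal ha, hreal hb]

theorem smul_nonneg_real {c : ℝ} (hc : 0 ≤ c) {a : H →L[ℂ] H} (ha : 0 ≤ a) : 0 ≤ (c : ℂ) • a := by
  rw [nonneg_iff_inner] at ha ⊢
  intro ξ
  rw [smul_apply, inner_smul_left, Complex.conj_ofReal]
  exact mul_nonneg (Complex.zero_le_real.2 hc) (ha ξ)

theorem re_inner_smul_apply (c : ℝ) (a : H →L[ℂ] H) (ξ : H) :
    (inner ℂ (((c : ℂ) • a) ξ) ξ).re = c * (inner ℂ (a ξ) ξ).re := by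
  rw [smul_apply, inner_smul_left, Complex.conj_ofReal, Complex.re_ofReal_mul]

/-- The traced form of the convexity inequality, on a subspace of a band of `x + y`. -/
theorem rpow_mul_dim_le (hx : L0sa τ x) (hy : L0sa τ y) (hxp : IsPos x) (hyp : IsPos y)
    {p α β l l' : ℝ} (hp : 1 ≤ p) (hα : 0 < α) (hβ : 0 < β) (hαβ : α + β = 1) (hl : 0 < l)
    (hll : l ≤ l') (m : ℕ) {K : Submodule ℂ H} (hK : IsAff M K)
    (hKz : K ≤ bandSub (closedAdd x y) l l')
    (hKx : K ≤ specSub (invOneAddAbsSq x) (level m))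
    (hKy : K ≤ specSub (invOneAddAbsSq y) (level m)) :
    ENNReal.ofReal (l ^ p) * dim τ K ≤
      ENNReal.ofReal (α ^ (1 - p)) * τ.toFun (proj K * truncAbsPow p m x * proj K) +
      ENNReal.ofReal (β ^ (1 - p)) * τ.toFun (proj K * truncAbsPow p m y * proj K) := by
  have hq := proj_isSelfAdjoint K
  have hA := conj_nonneg (truncAbsPow_nonneg p m x) hq
  have hB := conj_nonneg (truncAbsPow_nonneg p m y) hq
  have hAM : proj K * truncAbsPow p m x * proj K ∈ M :=
    mul_mem (mul_mem hK.proj_mem (truncAbsPow_mem hx p m)) hK.proj_mem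
  have hBM : proj K * truncAbsPow p m y * proj K ∈ M :=
    mul_mem (mul_mem hK.proj_mem (truncAbsPow_mem hy p m)) hK.proj_mem
  have hα' := Real.rpow_nonneg hα.le (1 - p)
  have hβ' := Real.rpow_nonneg hβ.le (1 - p)
  have hl' := Real.rpow_nonneg hl.le p
  unfold dim
  rw [← trace_smul hl' hK.proj_mem (proj_nonneg K), ← trace_smul hα' hAM hA,
    ← trace_smul hβ' hBM hB, ← τ.map_add _ _ (smul_mem_algebra _ hAM) (smul_mem_algebra _ hBM)
      (smul_nonneg_real hα' hA) (smul_nonneg_real hβ' hB)]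
  have hS := add_nonneg (smul_nonneg_real hα' hA) (smul_nonneg_real hβ' hB)
  have hL := smul_nonneg_real hl' (proj_nonneg K)
  refine trace_mono τ (smul_mem_algebra _ hK.proj_mem)
    (add_mem (smul_mem_algebra _ hAM) (smul_mem_algebra _ hBM)) hL
    (le_of_re_inner hL.isSelfAdjoint hS.isSelfAdjoint fun ξ => ?_)
  have hm := proj_mem hK.closed ξ
  have h := rpow_le_of_mem_bandSub hx hy hxp hyp hp hα hβ hαβ hl hll m (hKz hm) (hKx hm) (hKy hm)
  rw [add_apply, inner_add_left, Complex.add_re, re_inner_smul_apply, re_inner_smul_apply,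
    re_inner_smul_apply, inner_conj hq, inner_conj hq, inner_proj, Complex.ofReal_re]
  exact h

/-- A lower Riemann sum for `τ((x + y) ^ p)` is controlled by `x` and `y`. The bands of `x + y` are
cut down to the regions where `x` and `y` are bounded by `m`, which costs less and less trace as
`m → ∞`; no band needs to have finite trace. -/
theorem sum_rpow_mul_dim_le (hx : L0sa τ x) (hy : L0sa τ y) (hxp : IsPos x) (hyp : IsPos y)
    {p α β : ℝ} (hp : 1 ≤ p) (hα : 0 < α) (hβ : 0 < β) (hαβ : α + β = 1) {l : ℕ → ℝ}
    (hl : ∀ i, 0 < l i) (hmono : Monotone l) (N : ℕ) :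
    ∑ i ∈ Finset.range N, ENNReal.ofReal (l i ^ p) *
        dim τ (bandSub (closedAdd x y) (l i) (l (i + 1))) ≤
      ENNReal.ofReal (α ^ (1 - p)) * (⨆ n, τ.toFun (truncAbsPow p n x)) +
      ENNReal.ofReal (β ^ (1 - p)) * (⨆ n, τ.toFun (truncAbsPow p n y)) := by
  have hz := hx.add hy
  set Q : ℕ → Submodule ℂ H := fun i => bandSub (closedAdd x y) (l i) (l (i + 1)) with hQ
  have hQa : ∀ i, IsAff M (Q i) := fun i => bandSub_isAff hz _ _
  set X := ENNReal.ofReal (α ^ (1 - p)) * (⨆ n, τ.toFun (truncAbsPow p n x)) +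
      ENNReal.ofReal (β ^ (1 - p)) * (⨆ n, τ.toFun (truncAbsPow p n y)) with hX
  let Wx : ℕ → Submodule ℂ H := fun m => specSub (invOneAddAbsSq x) (level m)
  let Wy : ℕ → Submodule ℂ H := fun m => specSub (invOneAddAbsSq y) (level m)
  have hWx : ∀ m, IsAff M (Wx m) := fun m => specSub_isAff (inv_mem hx.closed hx.affiliated).1 _
  have hWy : ∀ m, IsAff M (Wy m) := fun m => specSub_isAff (inv_mem hy.closed hy.affiliated).1 _
  have hsumQ : ∑ i ∈ Finset.range N, proj (Q i) ≤ 1 := by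
    have e : ∀ i, proj (Q i) = proj (specSub (invOneAddAbsSq (closedAdd x y)) (level (l (i + 1)))) -
        proj (specSub (invOneAddAbsSq (closedAdd x y)) (level (l i))) := fun i =>
      proj_bandSub _ (hl i).le (hmono (Nat.le_succ i))
    simp only [e]
    rw [Finset.sum_range_sub fun i =>
      proj (specSub (invOneAddAbsSq (closedAdd x y)) (level (l i)))]
    refine (sub_le_self _ (proj_nonneg _)).trans ?_
    rw [← sub_nonneg, ← proj_orthogonal]
    exact proj_nonneg _
  -- The blocks cut down to the region where `x` and `y` are bounded by `m`.
  have hcut : ∀ m, ∑ i ∈ Finset.range N, ENNReal.ofReal (l i ^ p) *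
      dim τ (Q i ⊓ (Wx m ⊓ Wy m)) ≤ X := fun m => by
    have hKa : ∀ i, IsAff M (Q i ⊓ (Wx m ⊓ Wy m)) := fun i =>
      (hQa i).inf ((hWx m).inf (hWy m))
    have hsumK : ∑ i ∈ Finset.range N, proj (Q i ⊓ (Wx m ⊓ Wy m)) ≤ 1 :=
      (Finset.sum_le_sum fun i _ => proj_le_proj (hKa i).closed (hQa i).closed inf_le_left).trans
        hsumQ
    refine (Finset.sum_le_sum fun i _ => rpow_mul_dim_le hx hy hxp hyp hp hα hβ hαβ (hl i)
      (hmono (Nat.le_succ i)) m (hKa i) inf_le_left (inf_le_right.trans inf_le_left)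
      (inf_le_right.trans inf_le_right)).trans ?_
    rw [Finset.sum_add_distrib, ← Finset.mul_sum, ← Finset.mul_sum, hX]
    gcongr
    · exact (sum_trace_conj_le (truncAbsPow_mem hx p m) (truncAbsPow_nonneg p m x) _ hKa
        hsumK).trans (le_iSup (fun n => τ.toFun (truncAbsPow p n x)) m)
    · exact (sum_trace_conj_le (truncAbsPow_mem hy p m) (truncAbsPow_nonneg p m y) _ hKa
        hsumK).trans (le_iSup (fun n => τ.toFun (truncAbsPow p n y)) m)
  set S := ∑ i ∈ Finset.range N, ENNReal.ofReal (l i ^ p) with hS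
  have hStop : S ≠ ∞ := by
    rw [hS]; exact ENNReal.sum_ne_top.2 fun i _ => ENNReal.ofReal_ne_top
  have hle : ∀ m, ∑ i ∈ Finset.range N, ENNReal.ofReal (l i ^ p) * dim τ (Q i) ≤
      X + S * (dim τ (Wx m)ᗮ + dim τ (Wy m)ᗮ) := fun m => by
    calc ∑ i ∈ Finset.range N, ENNReal.ofReal (l i ^ p) * dim τ (Q i)
        ≤ ∑ i ∈ Finset.range N, (ENNReal.ofReal (l i ^ p) * dim τ (Q i ⊓ (Wx m ⊓ Wy m)) +
          ENNReal.ofReal (l i ^ p) * (dim τ (Wx m)ᗮ + dim τ (Wy m)ᗮ)) := by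
          refine Finset.sum_le_sum fun i _ => ?_
          rw [← mul_add]
          gcongr
          refine (dim_le_dim_inf_add ((hWx m).inf (hWy m)) (hQa i)).trans ?_
          gcongr
          exact dim_inf_orthogonal_le (hWx m) (hWy m)
      _ ≤ _ := by
          rw [Finset.sum_add_distrib, ← Finset.sum_mul]
          gcongr
          exact hcut m
  have hlim : Tendsto (fun m => X + S * (dim τ (Wx m)ᗮ + dim τ (Wy m)ᗮ)) atTop (𝓝 X) := by
    have h1 := (tendsto_dim_specSub hx).add (tendsto_dim_specSub hy)
    have h2 := (ENNReal.Tendsto.const_mul h1 (Or.inr hStop)).const_add X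
    simpa using h2
  exact ge_of_tendsto hlim (Eventually.of_forall hle)

/-- If all lower Riemann sums for `τ(x ^ p)` are at most `X`, then `τ(min (x, n) ^ p) ≤ θ ^ p X` for
every `θ > 1`: over a geometric ladder of ratio `θ`, upper and lower sums differ by the factor
`θ ^ p`. -/
theorem trace_truncAbsPow_le (hx : L0sa τ x) {p θ : ℝ} (hp : 1 ≤ p) (hθ : 1 < θ) {X : ℝ≥0∞}
    (hX : ∀ (l : ℕ → ℝ) (N : ℕ), (∀ i, 0 < l i) → Monotone l →
      ∑ i ∈ Finset.range N, ENNReal.ofReal (l i ^ p) * dim τ (bandSub x (l i) (l (i + 1))) ≤ X)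
    (n : ℕ) : τ.toFun (truncAbsPow p n x) ≤ ENNReal.ofReal (θ ^ p) * X := by
  have hp0 : 0 ≤ p := zero_le_one.trans hp
  have hθ0 : 0 < θ := zero_lt_one.trans hθ
  have hsM := (inv_mem hx.closed hx.affiliated).1
  have hs := invOneAddAbsSq_isSelfAdjoint x
  set s := invOneAddAbsSq x with hsdef
  have hcont := continuous_truncFun_rpow (level_pos n) hp0
  have hcont2 := continuous_truncFun_rpow (level_pos n) (p := p / 2) (by positivity)
  set r := truncAbsPow (p / 2) n x with hr
  have hrM : r ∈ M := truncAbsPow_mem hx _ _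
  have hrs : IsSelfAdjoint r := (truncAbsPow_nonneg _ _ x).isSelfAdjoint
  have hrr : r * r = truncAbsPow p n x := by
    rw [hr, truncAbsPow_eq, truncAbsPow_eq, ← cfc_mul _ _ _ hcont2.continuousOn hcont2.continuousOn]
    refine cfc_congr fun t _ => ?_
    rw [← Real.rpow_add_of_nonneg (truncFun_nonneg _ _) (by positivity) (by positivity), add_halves]
  -- The ladder `θ ^ (i - k)`, `0 ≤ i ≤ 2 k`; as `k → ∞` its bands exhaust the support of `x`.
  let l : ℕ → ℕ → ℝ := fun k i => θ ^ i / θ ^ k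
  have hl : ∀ k i, 0 < l k i := fun k i => by positivity
  have hlmono : ∀ k, Monotone (l k) := fun k i j hij =>
    div_le_div_of_nonneg_right (pow_le_pow_right₀ hθ.le hij) (by positivity)
  let E : ℝ → H →L[ℂ] H := fun t => proj (specSub s (level t))
  have hEM : ∀ t, E t ∈ M := fun t => (specSub_isAff hsM _).proj_mem
  have hE : ∀ {t t' : ℝ}, 0 ≤ t → t ≤ t' → E t ≤ E t' := fun h0 h =>
    proj_le_proj (isClosed_specSub _ _) (isClosed_specSub _ _) (specSub_anti s (level_anti h0 h))
  let G : ℕ → H →L[ℂ] H := fun k => E (l k (2 * k)) - E (l k 0)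
  have hG : ∀ k, G k = ∑ i ∈ Finset.range (2 * k), proj (bandSub x (l k i) (l k (i + 1))) := by
    intro k
    simp only [fun i => proj_bandSub x (hl k i).le (hlmono k (Nat.le_succ i))]
    rw [Finset.sum_range_sub fun i => proj (specSub (invOneAddAbsSq x) (level (l k i)))]
  have hband : ∀ k i, IsAff M (bandSub x (l k i) (l k (i + 1))) := fun k i => bandSub_isAff hx _ _
  have hCle : ∀ {t : ℝ}, 0 ≤ t → ∀ ξ ∈ specSub s (level t),
      (inner ℂ (truncAbsPow p n x ξ) ξ).re ≤ t ^ p * ‖ξ‖ ^ 2 := fun h0 ξ hξ =>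
    re_inner_cfc_le hs hξ hcont fun u hu =>
      Real.rpow_le_rpow (truncFun_nonneg _ _) (truncFun_le (level_pos n) h0 hu) hp0
  have hbound : ∀ k, τ.toFun (r * G k * r) ≤ ENNReal.ofReal (θ ^ p) * X := by
    intro k
    have e : r * G k * r =
        ∑ i ∈ Finset.range (2 * k), r * proj (bandSub x (l k i) (l k (i + 1))) * r := by
      rw [hG, Finset.mul_sum, Finset.sum_mul]
    rw [e, trace_sum _ (fun i _ => mul_mem (mul_mem hrM (hband k i).proj_mem) hrM)
      (fun i _ => conj_nonneg (proj_nonneg _) hrs)]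
    calc ∑ i ∈ Finset.range (2 * k), τ.toFun (r * proj (bandSub x (l k i) (l k (i + 1))) * r)
        ≤ ∑ i ∈ Finset.range (2 * k), ENNReal.ofReal (θ ^ p) * (ENNReal.ofReal (l k i ^ p) *
            dim τ (bandSub x (l k i) (l k (i + 1)))) := Finset.sum_le_sum fun i _ => ?_
      _ ≤ ENNReal.ofReal (θ ^ p) * X := by
        rw [← Finset.mul_sum]
        gcongr
        exact hX (l k) (2 * k) (hl k) (hlmono k)
    · rw [← trace_conj_comm hrM hrs (hband k i), hrr, ← mul_assoc,
        ← ENNReal.ofReal_mul (by positivity)]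
      have e1 : θ ^ p * l k i ^ p = l k (i + 1) ^ p := by
        rw [← Real.mul_rpow hθ0.le (hl k i).le]
        congr 1
        simp only [l]; rw [pow_succ]; ring
      have hl' := Real.rpow_nonneg (hl k (i + 1)).le p
      unfold dim
      rw [e1, ← trace_smul hl' (hband k i).proj_mem (proj_nonneg _)]
      have hq := proj_isSelfAdjoint (bandSub x (l k i) (l k (i + 1)))
      have h0 := conj_nonneg (truncAbsPow_nonneg p n x) hq
      refine trace_mono τ (mul_mem (mul_mem (hband k i).proj_mem (truncAbsPow_mem hx p n))
        (hband k i).proj_mem) (smul_mem_algebra _ (hband k i).proj_mem) h0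
        (le_of_re_inner h0.isSelfAdjoint
          (smul_nonneg_real hl' (proj_nonneg _)).isSelfAdjoint fun ξ => ?_)
      rw [inner_conj hq, re_inner_smul_apply, inner_proj, Complex.ofReal_re]
      exact hCle (hl k (i + 1)).le _ (proj_mem (hband k i).closed ξ).1
  have hG0 : ∀ k, 0 ≤ G k := fun k => sub_nonneg.2 (hE (hl k 0).le (hlmono k (Nat.zero_le _)))
  have hltop : ∀ k, l k (2 * k) = θ ^ k := fun k => by
    simp only [l]; rw [two_mul, pow_add]; field_simp
  have hlbot : ∀ k, l k 0 = 1 / θ ^ k := fun k => by simp [l]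
  have hGmono : Monotone G := fun k k' hk => by
    refine sub_le_sub (hE (hl _ _).le ?_) (hE (hl _ _).le ?_)
    · rw [hltop, hltop]; exact pow_le_pow_right₀ hθ.le hk
    · rw [hlbot, hlbot]
      exact one_div_le_one_div_of_le (by positivity) (pow_le_pow_right₀ hθ.le hk)
  have htop : Tendsto (fun k => l k (2 * k)) atTop atTop := by
    simp only [hltop]; exact tendsto_pow_atTop_atTop_of_one_lt hθ
  have hbot : Tendsto (fun k => l k 0) atTop (𝓝 0) := by
    simp only [hlbot, one_div]
    exact (tendsto_pow_atTop_atTop_of_one_lt hθ).inv_tendsto_atTop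
  have hsup : τ.toFun (truncAbsPow p n x) = ⨆ k, τ.toFun (r * G k * r) := by
    refine trace_eq_iSup τ (fun k => mul_mem (mul_mem hrM (sub_mem (hEM _) (hEM _))) hrM)
      (fun k => conj_nonneg (hG0 k) hrs) (fun k k' hk => ?_) (truncAbsPow_mem hx p n) fun ξ => ?_
    · rw [← sub_nonneg]
      have e : r * G k' * r - r * G k * r = r * (G k' - G k) * r := by noncomm_ring
      simp only [e]
      exact conj_nonneg (sub_nonneg.2 (hGmono hk)) hrs
    · simp only [inner_conj hrs]
      have e1 : inner ℂ (truncAbsPow p n x ξ) ξ = inner ℂ (r ξ - 0) (r ξ) := by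
        rw [← hrr, sub_zero]; exact inner_isSelfAdjoint hrs _ _
      rw [e1]
      refine Tendsto.inner ?_ tendsto_const_nhds
      refine Tendsto.sub ?_ ?_
      · refine tendsto_proj_specSub (invOneAddAbsSq_nonneg x) (fun ξ h => inv_injective hx.closed hx.dense h)
          (δ := fun k => level (l k (2 * k))) (fun k k' hk => level_anti (hl _ _).le ?_)
          (tendsto_level htop) (r ξ)
        rw [hltop, hltop]; exact pow_le_pow_right₀ hθ.le hk
      · rw [tendsto_zero_iff_norm_tendsto_zero]
        have h1 : ∀ k, ‖E (l k 0) (r ξ)‖ ≤ Real.sqrt (l k 0 ^ p * ‖ξ‖ ^ 2) := fun k => by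
          have h2 : E (l k 0) (r ξ) = r (E (l k 0) ξ) := proj_specSub_cfc hcont2 ξ
          have h3 := hCle (hl k 0).le _ (proj_mem (isClosed_specSub s (level (l k 0))) ξ)
          rw [← hrr] at h3
          have h4 : inner ℂ ((r * r) (E (l k 0) ξ)) (E (l k 0) ξ) =
              ((‖r (E (l k 0) ξ)‖ ^ 2 : ℝ) : ℂ) := by
            rw [← inner_self_complex]; exact inner_isSelfAdjoint hrs _ _
          have h5 : ‖r (E (l k 0) ξ)‖ ^ 2 ≤ l k 0 ^ p * ‖E (l k 0) ξ‖ ^ 2 := by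
            have h6 := h3
            rw [h4, Complex.ofReal_re] at h6
            exact h6
          rw [h2]
          refine Real.le_sqrt_of_sq_le (h5.trans ?_)
          have := norm_proj_le (specSub s (level (l k 0))) ξ
          gcongr
        refine squeeze_zero (fun _ => norm_nonneg _) h1 ?_
        have h7 : Tendsto (fun k => l k 0 ^ p * ‖ξ‖ ^ 2) atTop (𝓝 0) := by
          have h8 := (hbot.rpow_const (p := p) (Or.inr hp0)).mul_const (‖ξ‖ ^ 2)
          rwa [Real.zero_rpow (by positivity), zero_mul] at h8
        simpa using h7.sqrt
  rw [hsup]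
  exact iSup_le hbound

/-- Convexity of `x ↦ τ(x ^ p)`, written for the sum `x + y = α (x / α) + β (y / β)`. -/
theorem iSup_trace_closedAdd_le (hx : L0sa τ x) (hy : L0sa τ y) (hxp : IsPos x) (hyp : IsPos y)
    {p α β : ℝ} (hp : 1 ≤ p) (hα : 0 < α) (hβ : 0 < β) (hαβ : α + β = 1) :
    ⨆ n, τ.toFun (truncAbsPow p n (closedAdd x y)) ≤
      ENNReal.ofReal (α ^ (1 - p)) * (⨆ n, τ.toFun (truncAbsPow p n x)) +
      ENNReal.ofReal (β ^ (1 - p)) * (⨆ n, τ.toFun (truncAbsPow p n y)) := by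
  refine iSup_le fun n => ?_
  set X := ENNReal.ofReal (α ^ (1 - p)) * (⨆ n, τ.toFun (truncAbsPow p n x)) +
      ENNReal.ofReal (β ^ (1 - p)) * (⨆ n, τ.toFun (truncAbsPow p n y)) with hX
  have hle : ∀ θ : ℝ, 1 < θ →
      τ.toFun (truncAbsPow p n (closedAdd x y)) ≤ ENNReal.ofReal (θ ^ p) * X := fun θ hθ =>
    trace_truncAbsPow_le (hx.add hy) hp hθ
      (fun l N hl hm => sum_rpow_mul_dim_le hx hy hxp hyp hp hα hβ hαβ hl hm N) n
  rcases eq_or_ne X ∞ with htop | htop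
  · rw [htop]; exact le_top
  have hlim : Tendsto (fun θ : ℝ => ENNReal.ofReal (θ ^ p) * X) (𝓝[>] 1) (𝓝 X) := by
    have h1 : Tendsto (fun θ : ℝ => ENNReal.ofReal (θ ^ p)) (𝓝[>] 1) (𝓝 1) := by
      have h2 : ContinuousAt (fun θ : ℝ => θ ^ p) 1 :=
        Real.continuousAt_rpow_const 1 p (Or.inl one_ne_zero)
      have h3 := (ENNReal.tendsto_ofReal h2.tendsto).mono_left (nhdsWithin_le_nhds (s := Set.Ioi 1))
      simpa using h3
    simpa using ENNReal.Tendsto.mul_const h1 (Or.inr htop)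
  exact ge_of_tendsto hlim (eventually_nhdsWithin_of_forall fun θ hθ => hle θ hθ)

/-- Minkowski's inequality for positive measurable operators. -/
theorem lpNorm_closedAdd_le (hx : L0sa τ x) (hy : L0sa τ y) (hxp : IsPos x) (hyp : IsPos y)
    {p : ℝ} (hp : 1 ≤ p) :
    lpNorm τ p (closedAdd x y) ≤ lpNorm τ p x + lpNorm τ p y := by
  have hp0 : 0 < p := zero_lt_one.trans_le hp
  rcases eq_or_ne (lpNorm τ p x + lpNorm τ p y) ∞ with htop | htop
  · rw [htop]; exact le_top
  obtain ⟨hxt, hyt⟩ := ENNReal.add_ne_top.1 htop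
  have hI : ∀ z : H →ₗ.[ℂ] H, lpNorm τ p z ^ p = ⨆ n, τ.toFun (truncAbsPow p n z) := fun z => by
    unfold lpNorm
    rw [← ENNReal.rpow_mul, one_div_mul_cancel hp0.ne', ENNReal.rpow_one]
  refine ENNReal.le_of_forall_pos_le_add fun ε hε _ => ?_
  set A := (lpNorm τ p x).toReal + ε / 2 with hA
  set B := (lpNorm τ p y).toReal + ε / 2 with hB
  have hε' : (0 : ℝ) < ε := hε
  have hA0 : 0 < A := by positivity
  have hB0 : 0 < B := by positivity
  have hAB : 0 < A + B := by positivity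
  have hxA : lpNorm τ p x ^ p ≤ ENNReal.ofReal (A ^ p) := by
    rw [← ENNReal.ofReal_rpow_of_pos hA0]
    gcongr
    rw [← ENNReal.ofReal_toReal hxt]
    exact ENNReal.ofReal_le_ofReal (by rw [hA]; linarith)
  have hyB : lpNorm τ p y ^ p ≤ ENNReal.ofReal (B ^ p) := by
    rw [← ENNReal.ofReal_rpow_of_pos hB0]
    gcongr
    rw [← ENNReal.ofReal_toReal hyt]
    exact ENNReal.ofReal_le_ofReal (by rw [hB]; linarith)
  have hkey : ∀ {C : ℝ}, 0 < C → (C / (A + B)) ^ (1 - p) * C ^ p = (A + B) ^ (p - 1) * C := by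
    intro C hC
    rw [Real.div_rpow hC.le hAB.le, div_mul_eq_mul_div, ← Real.rpow_add hC, div_eq_mul_inv,
      ← Real.rpow_neg hAB.le, sub_add_cancel, Real.rpow_one, neg_sub, mul_comm]
  -- the weights `A / (A + B)` and `B / (A + B)` are optimal
  have h := iSup_trace_closedAdd_le hx hy hxp hyp hp (div_pos hA0 hAB) (div_pos hB0 hAB)
    (by rw [← add_div, div_self hAB.ne'])
  rw [← hI, ← hI, ← hI] at h
  have h2 : lpNorm τ p (closedAdd x y) ^ p ≤ ENNReal.ofReal (A + B) ^ p := by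
    calc lpNorm τ p (closedAdd x y) ^ p
        ≤ ENNReal.ofReal ((A / (A + B)) ^ (1 - p)) * ENNReal.ofReal (A ^ p) +
          ENNReal.ofReal ((B / (A + B)) ^ (1 - p)) * ENNReal.ofReal (B ^ p) := by
          refine h.trans ?_
          gcongr
      _ = ENNReal.ofReal (A + B) ^ p := by
          rw [← ENNReal.ofReal_mul (by positivity), ← ENNReal.ofReal_mul (by positivity),
            ← ENNReal.ofReal_add (by positivity) (by positivity), hkey hA0, hkey hB0, ← mul_add,
            ENNReal.ofReal_rpow_of_pos hAB, Real.rpow_sub_one hAB.ne']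
          congr 1
          field_simp
  have h3 := (ENNReal.rpow_le_rpow_iff hp0).1 h2
  refine h3.trans (le_of_eq ?_)
  have e : A + B = (lpNorm τ p x).toReal + (lpNorm τ p y).toReal + ε := by rw [hA, hB]; ring
  rw [e, ENNReal.ofReal_add (by positivity) (by positivity),
    ENNReal.ofReal_add (by positivity) (by positivity), ENNReal.ofReal_toReal hxt,
    ENNReal.ofReal_toReal hyt, ENNReal.ofReal_coe_nnreal]

end NCLp

namespace NCLp

variable {H : Type*} [NormedAddCommGroup H] [InnerProductSpace ℂ H] [CompleteSpace H]
  {M : VonNeumannAlgebra H} {τ : NSFTrace M} {x y : H →ₗ.[ℂ] H}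
  {T : M.toStarSubalgebra ≃⋆ₐ[ℂ] M.toStarSubalgebra}

/-! ### The dominating admissible sequence -/

theorem MemLpPos.l0sa {p : ℝ} (hx : MemLpPos τ p x) : L0sa τ x := hx.1.1.l0sa hx.2

theorem MemLpPos.closedAdd {p : ℝ} (hp : 1 ≤ p) (hx : MemLpPos τ p x) (hy : MemLpPos τ p y) :
    MemLpPos τ p (closedAdd x y) :=
  ⟨⟨(hx.l0sa.add hy.l0sa).memL0, (lpNorm_closedAdd_le hx.l0sa hy.l0sa hx.2 hy.2 hp).trans_lt
    (ENNReal.add_lt_top.2 ⟨hx.1.2, hy.1.2⟩)⟩, IsPos.closedAdd hx.l0sa hy.l0sa hx.2 hy.2⟩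

theorem MemLpPos.extend {p : ℝ} (hp : 1 ≤ p) (hTτ : IsTracePreserving τ T) (hx : MemLpPos τ p x) :
    MemLpPos τ p (extend T x) :=
  ⟨⟨(hx.l0sa.extend hTτ).memL0, by
    rw [lpNorm_extend hTτ hx.l0sa (zero_le_one.trans hp)]; exact hx.1.2⟩,
    isPos_extend hTτ hx.l0sa hx.2⟩

/-- The sequence `z_k = ∑_{j ≤ k} T^{k-j} r_j`, defined through `z_{k+1} = T z_k + r_{k+1}`. -/
noncomputable def orbitSum (T : M.toStarSubalgebra ≃⋆ₐ[ℂ] M.toStarSubalgebra)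
    (r : ℕ → H →ₗ.[ℂ] H) : ℕ → H →ₗ.[ℂ] H
  | 0 => r 0
  | k + 1 => closedAdd (extend T (orbitSum T r k)) (r (k + 1))

theorem orbitSum_memLpPos {p : ℝ} (hp : 1 ≤ p) (hTτ : IsTracePreserving τ T)
    {r : ℕ → H →ₗ.[ℂ] H} (hr : ∀ k, MemLpPos τ p (r k)) (k : ℕ) :
    MemLpPos τ p (orbitSum T r k) := by
  induction k with
  | zero => exact hr 0
  | succ k ih => exact (ih.extend hp hTτ).closedAdd hp (hr _)

theorem lpNorm_orbitSum_le {p : ℝ} (hp : 1 ≤ p) (hTτ : IsTracePreserving τ T)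
    {r : ℕ → H →ₗ.[ℂ] H} (hr : ∀ k, MemLpPos τ p (r k)) (k : ℕ) :
    lpNorm τ p (orbitSum T r k) ≤ ∑ j ∈ Finset.range (k + 1), lpNorm τ p (r j) := by
  induction k with
  | zero => simp [orbitSum]
  | succ k ih =>
    have hz := orbitSum_memLpPos hp hTτ hr k
    have hTz := hz.extend hp hTτ
    rw [Finset.sum_range_succ]
    refine (lpNorm_closedAdd_le hTz.l0sa (hr _).l0sa hTz.2 (hr _).2 hp).trans ?_
    rw [lpNorm_extend hTτ hz.l0sa (zero_le_one.trans hp)]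
    gcongr

/-- Adding a common summand preserves domination: from `a ≤ b + c` follows
`a + d ≤ b + (d + c)`. -/
theorem opLE_add {a b c d : H →ₗ.[ℂ] H} (ha : L0sa τ a) (hb : L0sa τ b) (hc : L0sa τ c)
    (hd : L0sa τ d) (h : OpLE a (closedAdd b c)) :
    OpLE (closedAdd a d) (closedAdd b (closedAdd d c)) := by
  have hD := (ha.tauDense.inf hb.tauDense).inf (hc.tauDense.inf hd.tauDense)
  refine ((hb.add (hd.add hc)).sub (ha.add hd)).isPos_of_tauDense hD fun ξ hξ => ?_
  have ga := a.mem_graph ⟨ξ, hξ.1.1⟩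
  have gb := b.mem_graph ⟨ξ, hξ.1.2⟩
  have gc := c.mem_graph ⟨ξ, hξ.2.1⟩
  have gd := d.mem_graph ⟨ξ, hξ.2.2⟩
  have h1 := mem_graph_closedSub (mem_graph_closedAdd gb (mem_graph_closedAdd gd gc))
    (mem_graph_closedAdd ga gd)
  have h2 := isPos_iff_graph.1 h _ (mem_graph_closedSub (mem_graph_closedAdd gb gc) ga)
  refine ⟨_, h1, ?_⟩
  convert h2 using 2
  simp only
  abel

theorem opLE_closedAdd_self {a b : H →ₗ.[ℂ] H} (ha : L0sa τ a) (hb : L0sa τ b) (hbp : IsPos b) :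
    OpLE a (closedAdd a b) := by
  refine ((ha.add hb).sub ha).isPos_of_tauDense (ha.tauDense.inf hb.tauDense) fun ξ hξ => ?_
  have ga := a.mem_graph ⟨ξ, hξ.1⟩
  have gb := b.mem_graph ⟨ξ, hξ.2⟩
  refine ⟨_, mem_graph_closedSub (mem_graph_closedAdd ga gb) ga, ?_⟩
  rw [add_sub_cancel_left]
  exact hbp ⟨ξ, hξ.2⟩

theorem closedSub_closedAdd {a b : H →ₗ.[ℂ] H} (ha : L0sa τ a) (hb : L0sa τ b) :
    a = closedSub (closedAdd a b) b := by
  have h := (ha.add hb).sub hb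
  refine eq_of_agree (τ := τ) ha.closed ha.affiliated h.closed h.affiliated
    (ha.tauDense.inf hb.tauDense) fun ξ hξ => ?_
  have ga := a.mem_graph ⟨ξ, hξ.1⟩
  have gb := b.mem_graph ⟨ξ, hξ.2⟩
  have h1 := mem_graph_closedSub (mem_graph_closedAdd ga gb) gb
  rw [add_sub_cancel_right] at h1
  exact ⟨_, ga, h1⟩

end NCLp

theorem mainTheorem6 {H : Type*} [NormedAddCommGroup H] [InnerProductSpace ℂ H] [CompleteSpace H]
    (M : VonNeumannAlgebra H) (τ : NSFTrace M)
    (T : M.toStarSubalgebra ≃⋆ₐ[ℂ] M.toStarSubalgebra)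
    (hT : NCLp.IsNormalAut T) (hTτ : NCLp.IsTracePreserving τ T)
    (p : ℝ) (hp : 1 ≤ p) (x r : ℕ → H →ₗ.[ℂ] H)
    (hx : ∀ k, NCLp.MemLpPos τ p (x k)) (hxb : NCLp.IsStronglyBounded τ p x)
    (hr : ∀ k, NCLp.MemLpPos τ p (r k)) (hrs : ∑' j, NCLp.lpNorm τ p (r j) < ∞)
    (hxr : ∀ k, NCLp.OpLE (NCLp.extend T (x k)) (NCLp.closedAdd (x (k + 1)) (r (k + 1)))) :
    ∃ y z : ℕ → H →ₗ.[ℂ] H,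
      (∀ k, NCLp.MemLpPos τ p (y k)) ∧ NCLp.IsStronglyBounded τ p y ∧ NCLp.IsAdmissible T y ∧
      (∀ k, NCLp.MemLpPos τ p (z k)) ∧ NCLp.IsStronglyBounded τ p z ∧ NCLp.IsAdmissible T z ∧
      ∀ k, x k = NCLp.closedSub (y k) (z k) := by
  have hz := NCLp.orbitSum_memLpPos hp hTτ hr
  have hTz := fun k => (hz k).extend hp hTτ
  have hTx := fun k => (hx k).extend hp hTτ
  have hzb : ∀ k, NCLp.lpNorm τ p (NCLp.orbitSum T r k) ≤ ∑' j, NCLp.lpNorm τ p (r j) := fun k =>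
    (NCLp.lpNorm_orbitSum_le hp hTτ hr k).trans (ENNReal.sum_le_tsum _)
  refine ⟨fun k => NCLp.closedAdd (x k) (NCLp.orbitSum T r k), NCLp.orbitSum T r,
    fun k => (hx k).closedAdd hp (hz k), ?_, fun k => ?_, hz, (iSup_le hzb).trans_lt hrs,
    fun k => NCLp.opLE_closedAdd_self (hTz k).l0sa (hr (k + 1)).l0sa (hr (k + 1)).2,
    fun k => NCLp.closedSub_closedAdd (hx k).l0sa (hz k).l0sa⟩
  · refine lt_of_le_of_lt (iSup_le fun k => ?_) (ENNReal.add_lt_top.2 ⟨hxb, hrs⟩)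
    exact (NCLp.lpNorm_closedAdd_le (hx k).l0sa (hz k).l0sa (hx k).2 (hz k).2 hp).trans
      (add_le_add (le_iSup (fun k => NCLp.lpNorm τ p (x k)) k) (hzb k))
  · have e := NCLp.extend_closedAdd hTτ (hx k).l0sa (hz k).l0sa
    change NCLp.OpLE (NCLp.extend T (NCLp.closedAdd (x k) (NCLp.orbitSum T r k))) _
    rw [e]
    exact NCLp.opLE_add (hTx k).l0sa (hx (k + 1)).l0sa (hr (k + 1)).l0sa (hTz k).l0sa (hxr k)
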